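/- Let $X$ be a time-homogeneous real-valued Markov process with transition densities $p_t(x,y)$, $t>0$, which are continuous in $(x,y)$ and satisfy the Chapman--Kolmogorov equations for all $x,y$ (for instance scaled Brownian motion or an Ornstein--Uhlenbeck process). Let $T>0$, $x_0,x_T\in\mathbb R$, $m\ge 1$, $\delta=T/(m+1)$, and place $m$ anchors at $\delta,2\delta,\dots,m\delta$. Let $\mathcal G=(X_{\delta},\dots,X_{m\delta})\,|\,(X_0=x_0,X_T=x_T)$ be the vector of knots of the bridge, with law $\pi$ on $\mathbb R^m$ of density $\prod_{i=0}^{m}p_\delta(z_i,z_{i+1})/p_T(x_0,x_T)$ (where $z_0=x_0$, $z_{m+1}=x_T$), and assume that $\pi$ is Gaussian. Let $\Sigma$ be its covariance matrix, $\Lambda=\Sigma^{-1}$, and $A=I-\mathrm{diag}(\Lambda_{11}^{-1},\dots,\Lambda_{mm}^{-1})\Lambda$. Updating a block $I\subseteq\{1,\dots,m\}$ means redrawing the coordinates in $I$ from their conditional law under $\pi$ given the other coordinates, which are kept. One sweep of the checkerboard scheme updates first $\mathcal A_1$ and then $\mathcal A_2$, where $\mathcal A_1\sqcup\mathcal A_2=\{1,\dots,m\}$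 are interlaced (between two elements of one block there is an element of the other); one sweep of the lexicographic scheme updates $\{1\},\{2\},\dots,\{m\}$ in this order; one sweep of the random scheme consists of $m$ successive updates of single coordinates, each chosen independently and uniformly from $\{1,\dots,m\}$. The $L^2$-convergence rate of a Markov chain with kernel $P$ and invariant law $\pi$ is the least $\rho\ge0$ such that for every $f\in L^2(\pi)$ there is $V_f>0$ with $\|P^nf-\pi(f)\|_{L^2(\pi)}\le V_f\,r^n$ for all $r>\rho$ and $n\ge 0$, where $\|g\|_{L^2(\pi)}=(\int g^2\,d\pi)^{1/2}$. Then, with $c=c(\delta)=\mathrm{Corr}(X_\delta,X_{2\delta}\mid X_0=u,X_{3\delta}=v)$ for arbitrary $u,v\in\mathbb R$ (the choice of $u,v$ is immaterial), the largest eigenvalue of $A$ is $$\lambda_{\max}(A)=2|c|\cos\Big(\frac{\pi}{m+1}\Big),$$ the $L^2$-convergence rates of the checkerboard scheme (for every interlaced partition) and of the lexicographic scheme are both equal to $$4c^2\cos^2\Big(\frac{\pi}{m+1}\Big),$$ and the $L^2$-convergence rate of the random scheme is $$\left[\frac{m-1+2|c|\cos\big(\frac{\pi}{m+1}\big)}{m}\right]^m.$$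 -/

import Mathlib

open MeasureTheory ProbabilityTheory
open scoped ENNReal

/-! ### Time-homogeneous Markov processes on the line and their bridges -/

/-- The transition densities `p t x y` (density at `y` of the state at time `t`, started from `x`)
of a time-homogeneous real-valued Markov process. -/
structure TransitionDensity where
  /-- the density -/
  p : ℝ → ℝ → ℝ → ℝ
  nonneg : ∀ t, 0 < t → ∀ x y, 0 ≤ p t x y
  continuous : ∀ t, 0 < t → Continuous fun z : ℝ × ℝ => p t z.1 z.2
  total : ∀ t, 0 < t → ∀ x, ∫⁻ y, ENNReal.ofReal (p t x y) = 1
  chapman_kolmogorov : ∀ s t, 0 < s → 0 < t → ∀ x y,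
    ∫⁻ z, ENNReal.ofReal (p s x z) * ENNReal.ofReal (p t z y) = ENNReal.ofReal (p (s + t) x y)

/-- The equidistant times `0, δ, 2δ, …, (m+1)δ`: the two end-points and the `m` anchors. -/
noncomputable def equidistant (m : ℕ) (δ : ℝ) : Fin (m + 2) → ℝ := fun i => (i : ℝ) * δ

/-- The values of the path at both end-points and at the knots: `x, z₁, …, z_m, y`. -/
noncomputable def withEnds {m : ℕ} (x y : ℝ) (z : Fin m → ℝ) : Fin (m + 2) → ℝ :=
  Fin.cons x (Fin.snoc z y : Fin (m + 1) → ℝ)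

/-- The law of the knots `(X_{k₁}, …, X_{k_m})` of the bridge, i.e. of the process conditioned on
`X_{k₀} = x` and `X_{k_{m+1}} = y`: its density is the joint transition density
`∏ p(k_{i+1} - k_i, z_i, z_{i+1})` divided by `p(k_{m+1} - k₀, x, y)`. -/
noncomputable def TransitionDensity.knotLaw (P : TransitionDensity) {m : ℕ}
    (k : Fin (m + 2) → ℝ) (x y : ℝ) : Measure (Fin m → ℝ) :=
  volume.withDensity fun z => ENNReal.ofReal
    ((∏ i : Fin (m + 1), P.p (k i.succ - k i.castSucc)
        (withEnds x y z i.castSucc) (withEnds x y z i.succ))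
      / P.p (k (Fin.last (m + 1)) - k 0) x y)

/-- The correlation of two real random variables. -/
noncomputable def corr {Ω : Type*} [MeasurableSpace Ω] (X Y : Ω → ℝ) (μ : Measure Ω) : ℝ :=
  covariance X Y μ / Real.sqrt (variance X μ * variance Y μ)

/-- `Corr(X_δ, X_{2δ} | X_0 = u, X_{3δ} = v)`. -/
noncomputable def TransitionDensity.bridgeCorr (P : TransitionDensity) (δ u v : ℝ) : ℝ :=
  corr (fun z : Fin 2 → ℝ => z 0) (fun z => z 1) (P.knotLaw (equidistant 2 δ) u v)

/-! ### The matrix `A` -/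

/-- The covariance matrix of the law `π` on `ℝ^m`. -/
noncomputable def covMatrix {m : ℕ} (π : Measure (Fin m → ℝ)) : Matrix (Fin m) (Fin m) ℝ :=
  Matrix.of fun i j => covariance (fun x => x i) (fun x => x j) π

/-- The precision matrix `Λ`, the inverse of the covariance matrix. -/
noncomputable def precMatrix {m : ℕ} (π : Measure (Fin m → ℝ)) : Matrix (Fin m) (Fin m) ℝ :=
  (covMatrix π)⁻¹

/-- `A = I - diag(Λ₁₁⁻¹, …, Λ_mm⁻¹) Λ`. -/
noncomputable def matrixA {m : ℕ} (π : Measure (Fin m → ℝ)) : Matrix (Fin m) (Fin m) ℝ :=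
  1 - Matrix.diagonal (fun i => (precMatrix π i i)⁻¹) * precMatrix π

/-- `l` is the largest (real) eigenvalue of `A`. -/
def IsMaxEigenvalue {m : ℕ} (A : Matrix (Fin m) (Fin m) ℝ) (l : ℝ) : Prop :=
  IsGreatest {l : ℝ | Module.End.HasEigenvalue (Matrix.toLin' A) l} l

/-! ### Blocked Gibbs samplers on the knots -/

/-- Overwrite the coordinates of `x` in the block `I` by `z`. -/
def overwrite {m : ℕ} (I : Finset (Fin m)) (x : Fin m → ℝ) (z : I → ℝ) : Fin m → ℝ :=
  fun i => if h : i ∈ I then z ⟨i, h⟩ else x i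

theorem measurable_overwrite {m : ℕ} (I : Finset (Fin m)) :
    Measurable fun w : (Fin m → ℝ) × (I → ℝ) => overwrite I w.1 w.2 := by
  refine measurable_pi_lambda _ fun i => ?_
  by_cases h : i ∈ I
  · simp only [overwrite, h, dif_pos]; fun_prop
  · simp only [overwrite, h, dif_neg, not_false_eq_true]; fun_prop

/-- The Gibbs update of the block `I` for the target law `π`: the coordinates in `I` are
redrawn from their conditional law under `π` given the coordinates outside `I`, and the latter
are kept. -/
noncomputable def gibbsUpdate {m : ℕ} (π : Measure (Fin m → ℝ)) [IsFiniteMeasure π]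
    (I : Finset (Fin m)) : Kernel (Fin m → ℝ) (Fin m → ℝ) :=
  (Kernel.id ×ₖ (condDistrib (I.restrict (π := fun _ => ℝ)) (Iᶜ.restrict (π := fun _ => ℝ)) π).comap
    (Iᶜ.restrict (π := fun _ => ℝ)) (Finset.measurable_restrict _)).map
      fun w => overwrite I w.1 w.2

/-- The mixture `x ↦ ∑ j, w j • κ j x` of finitely many kernels. -/
noncomputable def mixture {α β : Type*} [MeasurableSpace α] [MeasurableSpace β] {k : ℕ}
    (w : Fin k → ℝ≥0∞) (κ : Fin k → Kernel α β) : Kernel α β where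
  toFun x := ∑ j, w j • κ j x
  measurable' := by
    refine Measure.measurable_of_measurable_coe _ fun s hs => ?_
    simp only [Measure.coe_finsetSum, Finset.sum_apply, Measure.smul_apply, smul_eq_mul]
    exact Finset.measurable_sum _ fun j _ => ((κ j).measurable_coe hs).const_mul _

/-- A blocking scheme for `m` knots: the blocks `A₁, …, A_k` of (indices of) anchors, and the
probability `q i j` of updating block `j` in the `i`-th step of a sweep. -/
structure BlockingScheme (m : ℕ) where
  /-- number of blocks -/
  k : ℕ
  /-- the blocks -/
  A : Fin k → Finset (Fin m)
  /-- selection probabilities -/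
  q : Fin k → Fin k → ℝ≥0∞

/-- The transition kernel of one full sweep: for `i = 1, …, k` in this order, draw `I ~ q(i, ·)`
and update block `I`. -/
noncomputable def BlockingScheme.sweep {m : ℕ} (S : BlockingScheme m)
    (π : Measure (Fin m → ℝ)) [IsFiniteMeasure π] : Kernel (Fin m → ℝ) (Fin m → ℝ) :=
  (List.finRange S.k).foldl
    (fun K i => mixture (S.q i) (fun j => gibbsUpdate π (S.A j)) ∘ₖ K) Kernel.id

/-- `A₁, A₂` partition the anchors and are interlaced: between two anchors of one block there is
an anchor of the other one. -/
def IsInterlacedPartition {m : ℕ} (A : Fin 2 → Finset (Fin m)) : Prop :=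
  Disjoint (A 0) (A 1) ∧ A 0 ∪ A 1 = Finset.univ ∧
    ∀ i : Fin 2, ∀ a ∈ A i, ∀ c ∈ A i, a < c → ∃ b ∈ A (i + 1), a < b ∧ b < c

/-- Two blocks, updated in turn (the checkerboard scheme, if the blocks are interlaced). -/
noncomputable def checkerboard {m : ℕ} (A : Fin 2 → Finset (Fin m)) : BlockingScheme m where
  k := 2
  A := A
  q := fun i j => if j = i then 1 else 0

/-- The lexicographic scheme: single knots, updated in temporal order. -/
noncomputable def lexicographic (m : ℕ) : BlockingScheme m where
  k := m
  A := fun i => {i}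
  q := fun i j => if j = i then 1 else 0

/-- The random scheme: a sweep consists of `m` updates of uniformly chosen single knots. -/
noncomputable def randomScan (m : ℕ) : BlockingScheme m where
  k := m
  A := fun i => {i}
  q := fun _ _ => (m : ℝ≥0∞)⁻¹

/-- `ρ` is the `L²`-convergence rate of the Markov chain with transition kernel `P` and invariant
law `π`: the least nonnegative number such that for all square-integrable `f` there is
`V_f > 0` with `‖Pⁿ f - π(f)‖_{L²(π)} ≤ V_f rⁿ` for all `r > ρ` and all `n`.
The power of a kernel is its iterated composition. -/
def IsL2ConvergenceRate {α : Type*} [MeasurableSpace α] (π : Measure α) (P : Kernel α α)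
    (ρ : ℝ) : Prop :=
  IsLeast {ρ : ℝ | 0 ≤ ρ ∧ ∀ f : α → ℝ, MemLp f 2 π → ∃ V : ℝ, 0 < V ∧ ∀ r : ℝ, ρ < r → ∀ n : ℕ,
    eLpNorm (fun x => (∫ y, f y ∂((P ^ n) x)) - ∫ y, f y ∂π) 2 π ≤ ENNReal.ofReal (V * r ^ n)} ρ

/-! ### Orbit growth of symmetric operators on a Hilbert space -/

section GeometricGrowth

/-! Structure of the law. For `m ≥ 2`, Gaussianity of the knots and continuity of `p` make the sum
of `q = log p_δ` along the chain a quadratic polynomial in the knots. Varying two neighbouring knots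
gives `q s t = -β s t + F s + H t` with `F + H` quadratic (`exists_quadratic_of_chainSum`). Hence
`Λ` is tridiagonal with constant diagonal `α` and off-diagonal `β`, and `A` is `c = -β/α` times the
adjacency matrix of the path. The same `q` gives the two-knot bridge between any `u`, `v` the
precision matrix with rows `(α, β)`, `(β, α)`, whose correlation is again `-β/α`. The eigenvectors
needed are explicit sine waves, with top eigenvalue `γ = 2|c| cos(π/(m+1))`.

Reduction to matrices. Updating a block without neighbouring sites acts as `f ↦ E f(B x + R)`: `B`
replaces each updated coordinate by `c` times the sum of its neighbours, and the noise `R` is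
independent of the kept coordinates (`HasPathPrecision.isPrediction`). A modulus of continuity `N`
becomes `N ∘ B`, and the linear part `ℓ` of an affine function becomes `ℓ ∘ B`. A fixed-order sweep
is thus governed by a product `M` of such matrices. If heights `h` increase by one along every edge
in the direction of updating, the sine wave damped by `γ ^ h` is multiplied by `γ²` under `M`
(`RaisesWave`). For `|c|` and `γ > 0` this vector is positive, and entrywise domination gives `‖Mⁿ‖
≤ C γ²ⁿ`.

Passage to `L²`. The sweep operator `T` has as adjoint `T'` the sweep in reversed order, and both
contract Lipschitz constants. For the symmetric operator `T'ⁿ Tⁿ`, decay of the orbits of a dense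
set bounds the operator itself (`norm_apply_sub_le_of_dense`), so `Tⁿ` contracts centred functions
by `C γ²ⁿ`. Conversely, affine functions paired with a functional dual to an eigenvector of `M`
decay no faster (`exists_le_norm_pow_apply_sub`).

Random scan. One update is a self-adjoint average of projections. The `ℓ¹`-modulus weighted by the
sine wave contracts by `(m - 1 + γ)/m`, and the signed sine wave attains this factor. -/

theorem le_of_forall_mul_pow_le {A C t κ : ℝ} (hA : 0 < A) (hκ : 0 ≤ κ)
    (h : ∀ k : ℕ, A * t ^ k ≤ C * κ ^ k) : t ≤ κ := by
  by_contra! hlt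
  have ht : 0 < t := hκ.trans_lt hlt
  have hlim : Filter.Tendsto (fun k : ℕ => C * (κ / t) ^ k) Filter.atTop (nhds (C * 0)) :=
    (tendsto_pow_atTop_nhds_zero_of_lt_one (by positivity) ((div_lt_one ht).2 hlt)).const_mul C
  have hle : ∀ k : ℕ, A ≤ C * (κ / t) ^ k := fun k => by
    rw [div_pow, ← mul_div_assoc, le_div_iff₀ (by positivity)]
    exact h k
  have := ge_of_tendsto' hlim hle
  linarith

end GeometricGrowth

section Hilbert

variable {H : Type*} [NormedAddCommGroup H] [InnerProductSpace ℝ H]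

/-- For a symmetric operator the ratios `‖Sᵏ⁺¹ g‖ / ‖Sᵏ g‖` increase, so that the asymptotic
growth of the orbit of `g` controls its first step. -/
theorem norm_apply_le_of_norm_pow_apply_le (S : H →L[ℝ] H)
    (hS : ∀ x y, inner ℝ (S x) y = inner ℝ x (S y)) (g : H) {C κ : ℝ} (hκ : 0 ≤ κ)
    (h : ∀ k : ℕ, ‖(S ^ k) g‖ ≤ C * κ ^ k) : ‖S g‖ ≤ κ * ‖g‖ := by
  have succ : ∀ k, (S ^ (k + 1)) g = S ((S ^ k) g) := fun k => by rw [pow_succ']; rfl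
  -- By symmetry `‖Sᵏ⁺¹ g‖² = ⟪Sᵏ g, Sᵏ⁺² g⟫`, so the norms along the orbit are log-convex.
  have conv : ∀ k, ‖(S ^ (k + 1)) g‖ ^ 2 ≤ ‖(S ^ k) g‖ * ‖(S ^ (k + 2)) g‖ := fun k => by
    rw [← real_inner_self_eq_norm_sq, succ (k + 1), succ k, hS]
    exact real_inner_le_norm _ _
  have mono : ∀ k, ‖(S ^ k) g‖ * ‖S g‖ ≤ ‖(S ^ (k + 1)) g‖ * ‖g‖ := by
    intro k
    induction k with
    | zero => simp [mul_comm]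
    | succ k ih =>
      rcases (norm_nonneg ((S ^ (k + 1)) g)).eq_or_lt with h0 | hpos
      · rw [← h0]; simpa using mul_nonneg (norm_nonneg _) (norm_nonneg _)
      have hk : 0 < ‖(S ^ k) g‖ := by
        refine (norm_nonneg _).lt_of_ne fun h0 => ?_
        have := conv k
        rw [← h0, zero_mul] at this
        nlinarith
      refine le_of_mul_le_mul_left ?_ hk
      calc ‖(S ^ k) g‖ * (‖(S ^ (k + 1)) g‖ * ‖S g‖)
          = ‖(S ^ (k + 1)) g‖ * (‖(S ^ k) g‖ * ‖S g‖) := by ring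
        _ ≤ ‖(S ^ (k + 1)) g‖ * (‖(S ^ (k + 1)) g‖ * ‖g‖) := by gcongr
        _ = ‖(S ^ (k + 1)) g‖ ^ 2 * ‖g‖ := by ring
        _ ≤ (‖(S ^ k) g‖ * ‖(S ^ (k + 2)) g‖) * ‖g‖ := by gcongr; exact conv k
        _ = ‖(S ^ k) g‖ * (‖(S ^ (k + 1 + 1)) g‖ * ‖g‖) := by ring
  rcases (norm_nonneg g).eq_or_lt with h0 | hpos
  · have : g = 0 := norm_eq_zero.1 h0.symm
    simp [this]
  have grow : ∀ k, ‖g‖ * (‖S g‖ / ‖g‖) ^ k ≤ ‖(S ^ k) g‖ := by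
    intro k
    induction k with
    | zero => simp
    | succ k ih =>
      rw [pow_succ, ← mul_assoc]
      calc ‖g‖ * (‖S g‖ / ‖g‖) ^ k * (‖S g‖ / ‖g‖) ≤ ‖(S ^ k) g‖ * (‖S g‖ / ‖g‖) := by gcongr
        _ ≤ _ := by rw [← mul_div_assoc, div_le_iff₀ hpos]; exact mono k
  have := le_of_forall_mul_pow_le hpos hκ fun k => (grow k).trans (h k)
  rwa [div_le_iff₀ hpos] at this

/-- A contraction estimate off a common unit eigenvector, from the orbits of a dense set. -/
theorem norm_apply_sub_le_of_dense (T T' : H →L[ℝ] H)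
    (hT : ∀ x y, inner ℝ (T x) y = inner ℝ x (T' y)) {e : H} (he : T e = e) {D : Set H}
    (hD : Dense D) {a : ℝ} (ha : 0 ≤ a)
    (h : ∀ g ∈ D, ∃ C : ℝ, ∀ k : ℕ,
      ‖((T' * T) ^ k) (g - inner ℝ e g • e)‖ ≤ C * (a ^ 2) ^ k) (x : H) :
    ‖T x - inner ℝ e x • e‖ ≤ a * ‖x - inner ℝ e x • e‖ := by
  -- Both sides are continuous in `x`, so the estimate need only be checked on `D`.
  have closed : IsClosed {x : H | ‖T x - inner ℝ e x • e‖ ≤ a * ‖x - inner ℝ e x • e‖} :=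
    isClosed_le (by fun_prop) (by fun_prop)
  have sub : D ⊆ {x : H | ‖T x - inner ℝ e x • e‖ ≤ a * ‖x - inner ℝ e x • e‖} := by
    intro g hg
    obtain ⟨C, hC⟩ := h g hg
    set g0 := g - inner ℝ e g • e with hg0
    have hT' : ∀ x y, inner ℝ (T' x) y = inner ℝ x (T y) := fun x y => by
      rw [real_inner_comm, ← hT, real_inner_comm]
    have key := norm_apply_le_of_norm_pow_apply_le (T' * T)
      (fun x y => by change inner ℝ (T' (T x)) y = inner ℝ x (T' (T y)); rw [hT', hT])
      g0 (sq_nonneg a) hC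
    have e1 : T g - inner ℝ e g • e = T g0 := by rw [hg0, map_sub, map_smul, he]
    rw [Set.mem_ofPred_eq, e1]
    refine abs_le_of_sq_le_sq' ?_ (by positivity) |>.2
    calc ‖T g0‖ ^ 2 = inner ℝ g0 ((T' * T) g0) := by
          rw [← real_inner_self_eq_norm_sq, hT]; rfl
      _ ≤ ‖g0‖ * ‖(T' * T) g0‖ := real_inner_le_norm _ _
      _ ≤ ‖g0‖ * (a ^ 2 * ‖g0‖) := by gcongr
      _ = (a * ‖g0‖) ^ 2 := by ring
  exact closed.closure_subset_iff.2 sub (hD x)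

end Hilbert

/-! ### Kernels as operators on `L²(π)` -/

section Represents

variable {α : Type*} [MeasurableSpace α]

/-- The kernel `K` leaves `π` invariant and acts on `L²(π)` as the operator `T`. -/
def Represents (π : Measure α) (K : Kernel α α) (T : Lp ℝ 2 π →L[ℝ] Lp ℝ 2 π) : Prop :=
  K ∘ₘ π = π ∧ ∀ φ : Lp ℝ 2 π, (fun x => ∫ y, φ y ∂K x) =ᵐ[π] T φ

variable {π : Measure α}

/-- Invariance carries `π`-null sets to sets that are null for almost every `K x`. This makes the
action of `K` on classes in `L²` independent of representatives. -/
theorem ae_kernel_of_ae {K : Kernel α α} (hK : K ∘ₘ π = π) {p : α → Prop} (h : ∀ᵐ x ∂π, p x) :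
    ∀ᵐ x ∂π, ∀ᵐ y ∂K x, p y := by
  rw [← hK] at h
  exact Measure.ae_ae_of_ae_comp h

theorem Represents.integral_ae_eq {K : Kernel α α} {T : Lp ℝ 2 π →L[ℝ] Lp ℝ 2 π}
    (h : Represents π K T) {f : α → ℝ} {φ : Lp ℝ 2 π} (hf : f =ᵐ[π] φ) :
    (fun x => ∫ y, f y ∂K x) =ᵐ[π] T φ := by
  filter_upwards [h.2 φ, ae_kernel_of_ae h.1 hf] with x hx hy
  rw [← hx]
  exact integral_congr_ae hy

theorem represents_id : Represents π Kernel.id 1 :=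
  ⟨Measure.id_comp, fun φ => by
    filter_upwards with x
    rw [Kernel.id_apply, integral_dirac' _ _ (Lp.stronglyMeasurable φ)]
    rfl⟩

variable [IsProbabilityMeasure π]

/-- Kernels act on functions contravariantly: the later step `K'` hits the function first, so its
operator stands on the right. -/
theorem Represents.comp {K K' : Kernel α α} [IsMarkovKernel K] [IsMarkovKernel K']
    {T T' : Lp ℝ 2 π →L[ℝ] Lp ℝ 2 π} (h : Represents π K T) (h' : Represents π K' T') :
    Represents π (K' ∘ₖ K) (T * T') := by
  have inv : (K' ∘ₖ K) ∘ₘ π = π := by rw [← Measure.comp_assoc, h.1, h'.1]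
  refine ⟨inv, fun φ => ?_⟩
  have hint : Integrable φ ((K' ∘ₖ K) ∘ₘ π) := by
    rw [inv]; exact (Lp.memLp φ).integrable (by norm_num)
  filter_upwards [h.2 (T' φ), ae_kernel_of_ae h.1 (h'.2 φ),
    Measure.ae_integrable_of_integrable_comp hint] with x hx hy hi
  rw [Kernel.integral_comp hi, integral_congr_ae hy, hx]
  rfl

theorem isMarkovKernel_pow (K : Kernel α α) [IsMarkovKernel K] (n : ℕ) :
    IsMarkovKernel (K ^ n) := by
  induction n with
  | zero => exact inferInstanceAs (IsMarkovKernel Kernel.id)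
  | succ n ih => rw [pow_succ]; exact inferInstanceAs (IsMarkovKernel ((K ^ n) ∘ₖ K))

theorem Represents.pow {K : Kernel α α} [IsMarkovKernel K] {T : Lp ℝ 2 π →L[ℝ] Lp ℝ 2 π}
    (h : Represents π K T) (n : ℕ) : Represents π (K ^ n) (T ^ n) := by
  induction n with
  | zero => exact represents_id
  | succ n ih =>
    have := isMarkovKernel_pow K n
    rw [pow_succ, pow_succ']
    exact h.comp ih

theorem isMarkovKernel_mixture {k : ℕ} {w : Fin k → ℝ≥0∞} (hw : ∑ j, w j = 1)
    {κ : Fin k → Kernel α α} [∀ j, IsMarkovKernel (κ j)] : IsMarkovKernel (mixture w κ) :=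
  ⟨fun x => ⟨by simp [mixture, hw]⟩⟩

theorem Represents.mixture {k : ℕ} {w : Fin k → ℝ≥0∞} (hw : ∑ j, w j = 1)
    {κ : Fin k → Kernel α α} [∀ j, IsMarkovKernel (κ j)]
    {T : Fin k → Lp ℝ 2 π →L[ℝ] Lp ℝ 2 π} (h : ∀ j, Represents π (κ j) (T j)) :
    Represents π (mixture w κ) (∑ j, (w j).toReal • T j) := by
  have app : ∀ x, _root_.mixture w κ x = ∑ j, w j • κ j x := fun x => rfl
  have hwtop : ∀ j, w j ≠ ∞ := fun j => by
    refine ne_top_of_le_ne_top ENNReal.one_ne_top (hw ▸ Finset.single_le_sum (f := w) ?_ ?_)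
    · exact fun _ _ => zero_le
    · exact Finset.mem_univ j
  constructor
  · ext s hs
    rw [Measure.bind_apply hs (Kernel.aemeasurable _)]
    simp only [app, Measure.coe_finsetSum, Finset.sum_apply, Measure.smul_apply, smul_eq_mul]
    rw [lintegral_finsetSum _ fun j _ => ((κ j).measurable_coe hs).const_mul _]
    have : ∀ j, ∫⁻ x, w j * κ j x s ∂π = w j * π s := fun j => by
      rw [lintegral_const_mul _ ((κ j).measurable_coe hs)]
      conv_rhs => rw [← (h j).1, Measure.bind_apply hs (Kernel.aemeasurable _)]
    simp_rw [this, ← Finset.sum_mul, hw, one_mul]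
  · intro φ
    have hint : ∀ᵐ x ∂π, ∀ j, Integrable φ (κ j x) := ae_all_iff.2 fun j => by
      refine Measure.ae_integrable_of_integrable_comp ?_
      rw [(h j).1]
      exact (Lp.memLp φ).integrable (by norm_num)
    have hT : ∀ᵐ x ∂π, ∀ j, ∫ y, φ y ∂κ j x = T j φ x := ae_all_iff.2 fun j => (h j).2 φ
    have hsum : ((∑ j, (w j).toReal • T j) φ : Lp ℝ 2 π) =ᵐ[π]
        fun x => ∑ j, (w j).toReal * T j φ x := by
      rw [_root_.sum_apply]
      refine (Lp.coeFn_finsetSum _ _).trans ?_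
      have : ∀ᵐ x ∂π, ∀ j, ((w j).toReal • T j φ : Lp ℝ 2 π) x = (w j).toReal * T j φ x :=
        ae_all_iff.2 fun j => Lp.coeFn_smul _ _
      filter_upwards [this] with x hx
      simp only [Finset.sum_apply]
      exact Finset.sum_congr rfl fun j _ => hx j
    filter_upwards [hint, hT, hsum] with x h1 h2 h3
    rw [h3, app, integral_finsetSum_measure fun j _ => (h1 j).smul_measure (hwtop j)]
    exact Finset.sum_congr rfl fun j _ => by rw [integral_smul_measure, h2 j, smul_eq_mul]

/-- The operators of successively composed kernels multiply up in order. -/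
theorem Represents.foldl {ι : Type*} {κ : ι → Kernel α α} [∀ i, IsMarkovKernel (κ i)]
    {T : ι → Lp ℝ 2 π →L[ℝ] Lp ℝ 2 π} (h : ∀ i, Represents π (κ i) (T i)) (l : List ι)
    {K : Kernel α α} [hK : IsMarkovKernel K] {S : Lp ℝ 2 π →L[ℝ] Lp ℝ 2 π}
    (hS : Represents π K S) :
    IsMarkovKernel (l.foldl (fun K i => κ i ∘ₖ K) K) ∧
      Represents π (l.foldl (fun K i => κ i ∘ₖ K) K) (S * (l.map T).prod) := by
  induction l generalizing K S with
  | nil => simpa using ⟨hK, hS⟩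
  | cons i l ih =>
    simp only [List.foldl_cons, List.map_cons, List.prod_cons, ← mul_assoc]
    exact ih (hS.comp (h i))

/-- The constant function `1` as an element of `L²`. -/
noncomputable def oneLp (π : Measure α) [IsProbabilityMeasure π] : Lp ℝ 2 π := Lp.const 2 π 1

theorem coeFn_oneLp : oneLp π =ᵐ[π] fun _ => 1 := Lp.coeFn_const 2 π 1

theorem norm_oneLp : ‖oneLp π‖ = 1 := by
  rw [oneLp, Lp.norm_const (c := (1 : ℝ)) (p := 2) (μ := π) (by norm_num)]; simp

theorem inner_oneLp (φ : Lp ℝ 2 π) : inner ℝ (oneLp π) φ = ∫ x, φ x ∂π := by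
  rw [L2.inner_def]
  refine integral_congr_ae ?_
  filter_upwards [coeFn_oneLp (π := π)] with x hx
  simp [hx]

theorem Represents.oneLp {K : Kernel α α} [IsMarkovKernel K] {T : Lp ℝ 2 π →L[ℝ] Lp ℝ 2 π}
    (h : Represents π K T) : T (oneLp π) = oneLp π := by
  refine Lp.ext ?_
  filter_upwards [h.integral_ae_eq (coeFn_oneLp (π := π)).symm, coeFn_oneLp (π := π)] with x h1 h2
  rw [← h1, h2]; simp

/-- Translates the quantity in the definition of the rate into a Hilbert space norm, where the mean
is the projection on the constants. -/
theorem Represents.eLpNorm_sub {K : Kernel α α} {T : Lp ℝ 2 π →L[ℝ] Lp ℝ 2 π}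
    (h : Represents π K T) {f : α → ℝ} {φ : Lp ℝ 2 π} (hf : f =ᵐ[π] φ) :
    eLpNorm (fun x => (∫ y, f y ∂K x) - ∫ y, f y ∂π) 2 π
      = ENNReal.ofReal ‖T φ - inner ℝ (_root_.oneLp π) φ • _root_.oneLp π‖ := by
  rw [Lp.norm_def, ENNReal.ofReal_toReal (Lp.eLpNorm_ne_top _)]
  refine eLpNorm_congr_ae ?_
  filter_upwards [h.integral_ae_eq hf, coeFn_oneLp (π := π),
    Lp.coeFn_sub (T φ) (inner ℝ (_root_.oneLp π) φ • _root_.oneLp π),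
    Lp.coeFn_smul (inner ℝ (_root_.oneLp π) φ) (_root_.oneLp π)] with x h1 h2 h3 h4
  rw [h1, h3, Pi.sub_apply, h4, Pi.smul_apply, h2, inner_oneLp, integral_congr_ae hf]
  simp

/-- The rate of a kernel from two-sided estimates of its operator. -/
theorem isL2ConvergenceRate_of_represents {K : Kernel α α} [IsMarkovKernel K]
    {T : Lp ℝ 2 π →L[ℝ] Lp ℝ 2 π} (h : Represents π K T) {ρ C : ℝ} (hρ : 0 ≤ ρ) (hC : 0 ≤ C)
    (upper : ∀ (n : ℕ) (φ : Lp ℝ 2 π),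
      ‖(T ^ n) φ - inner ℝ (_root_.oneLp π) φ • _root_.oneLp π‖ ≤
        C * ρ ^ n * ‖φ - inner ℝ (_root_.oneLp π) φ • _root_.oneLp π‖)
    (lower : 0 < ρ → ∃ (φ : Lp ℝ 2 π) (A : ℝ), 0 < A ∧ ∀ n : ℕ,
      A * ρ ^ n ≤ ‖(T ^ n) φ - inner ℝ (_root_.oneLp π) φ • _root_.oneLp π‖) :
    IsL2ConvergenceRate π K ρ := by
  refine ⟨⟨hρ, fun f hf => ?_⟩, ?_⟩
  · set φ := hf.toLp f
    set N := ‖φ - inner ℝ (_root_.oneLp π) φ • _root_.oneLp π‖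
    -- The summand `1` keeps the constant positive when `φ` is constant.
    refine ⟨C * N + 1, by positivity, fun r hr n => ?_⟩
    rw [(h.pow n).eLpNorm_sub hf.coeFn_toLp.symm]
    refine ENNReal.ofReal_le_ofReal ((upper n φ).trans ?_)
    have h1 : ρ ^ n ≤ r ^ n := pow_le_pow_left₀ hρ hr.le n
    have h2 : 0 ≤ r ^ n := pow_nonneg (hρ.trans hr.le) n
    calc C * ρ ^ n * N = C * N * ρ ^ n := by ring
      _ ≤ C * N * r ^ n := by gcongr
      _ ≤ (C * N + 1) * r ^ n := by nlinarith
  · rintro ρ' ⟨hρ', hV⟩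
    rcases hρ.eq_or_lt with h0 | hpos
    · exact h0 ▸ hρ'
    obtain ⟨φ, A, hA, hlow⟩ := lower hpos
    obtain ⟨V, hVpos, hV⟩ := hV φ (Lp.memLp φ)
    -- The bound for `ρ'` is available only at exponents strictly above it, hence the intermediate
    -- `s`.
    refine le_of_forall_gt fun r hr => ?_
    obtain ⟨s, hs, hsr⟩ := exists_between hr
    refine lt_of_le_of_lt (le_of_forall_mul_pow_le (C := V) hA (hρ'.trans hs.le) fun n => ?_) hsr
    have := hV s hs n
    rw [(h.pow n).eLpNorm_sub (ae_eq_refl _)] at this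
    have hs0 : 0 ≤ s := hρ'.trans hs.le
    exact (hlow n).trans ((ENNReal.ofReal_le_ofReal_iff (by positivity)).1 this)

end Represents

/-! ### Gibbs updates as conditional expectations -/

section GibbsOperator

variable {m : ℕ}

/-- The vector with coordinates `z` in the block `I` and `a` outside of it. -/
def glue (I : Finset (Fin m)) (a : (Iᶜ : Finset (Fin m)) → ℝ) (z : I → ℝ) : Fin m → ℝ :=
  fun i => if h : i ∈ I then z ⟨i, h⟩ else a ⟨i, Finset.mem_compl.2 h⟩

theorem measurable_glue (I : Finset (Fin m)) :
    Measurable fun w : ((Iᶜ : Finset (Fin m)) → ℝ) × (I → ℝ) => glue I w.1 w.2 := by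
  refine measurable_pi_lambda _ fun i => ?_
  by_cases h : i ∈ I
  · simp only [glue, h, dif_pos]; fun_prop
  · simp only [glue, h, dif_neg, not_false_eq_true]; fun_prop

theorem measurable_glue_right (I : Finset (Fin m)) (a : (Iᶜ : Finset (Fin m)) → ℝ) :
    Measurable (glue I a) :=
  (measurable_glue I).comp (measurable_const.prodMk measurable_id : Measurable fun z => (a, z))

theorem glue_restrict (I : Finset (Fin m)) (x : Fin m → ℝ) :
    glue I (Iᶜ.restrict (π := fun _ => ℝ) x) (I.restrict (π := fun _ => ℝ) x) = x := by
  ext i; by_cases h : i ∈ I <;> simp [glue, h]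

variable (π : Measure (Fin m → ℝ)) [IsProbabilityMeasure π]

/-- The σ-algebra generated by the coordinates outside the block `I`. -/
@[reducible]
def outsideBlock (I : Finset (Fin m)) : MeasurableSpace (Fin m → ℝ) :=
  MeasurableSpace.comap (Iᶜ.restrict (π := fun _ => ℝ)) inferInstance

theorem outsideBlock_le (I : Finset (Fin m)) : outsideBlock I ≤ MeasurableSpace.pi :=
  (Finset.measurable_restrict _).comap_le

/-- The Gibbs update of a block as an orthogonal projection of `L²`. -/
noncomputable def gibbsOp (I : Finset (Fin m)) : Lp ℝ 2 π →L[ℝ] Lp ℝ 2 π :=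
  (lpMeas ℝ ℝ (outsideBlock I) 2 π).subtypeL ∘L condExpL2 ℝ ℝ (outsideBlock_le I)

omit [IsProbabilityMeasure π] in
theorem inner_gibbsOp (I : Finset (Fin m)) (φ ψ : Lp ℝ 2 π) :
    inner ℝ (gibbsOp π I φ) ψ = inner ℝ φ (gibbsOp π I ψ) :=
  inner_condExpL2_left_eq_right (outsideBlock_le I)

theorem gibbsOp_ae_eq (I : Finset (Fin m)) (φ : Lp ℝ 2 π) :
    gibbsOp π I φ =ᵐ[π] π[φ | outsideBlock I] := by
  have := (Lp.memLp φ).condExpL2_ae_eq_condExp (𝕜 := ℝ) (outsideBlock_le I)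
  rwa [Lp.toLp_coeFn] at this

theorem gibbsUpdate_apply (I : Finset (Fin m)) (x : Fin m → ℝ) :
    gibbsUpdate π I x = (condDistrib (I.restrict (π := fun _ => ℝ))
      (Iᶜ.restrict (π := fun _ => ℝ)) π (Iᶜ.restrict (π := fun _ => ℝ) x)).map
        (glue I (Iᶜ.restrict (π := fun _ => ℝ) x)) := by
  rw [gibbsUpdate, Kernel.map_apply _ (measurable_overwrite I), Kernel.prod_apply,
    Kernel.id_apply, Kernel.comap_apply, Measure.dirac_prod, Measure.map_map
      (measurable_overwrite I) (by fun_prop)]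
  rfl

instance (I : Finset (Fin m)) : IsMarkovKernel (gibbsUpdate π I) := by
  rw [gibbsUpdate]
  exact Kernel.IsMarkovKernel.map _ (measurable_overwrite I)

/-- The law of the outside coordinates composed with the conditional law of the block is the joint
law, and gluing the two parts recovers `π`. -/
theorem gibbsUpdate_invariant (I : Finset (Fin m)) : gibbsUpdate π I ∘ₘ π = π := by
  have hX : Measurable (Iᶜ.restrict (π := fun _ => ℝ) : (Fin m → ℝ) → _) :=
    Finset.measurable_restrict _
  have hY : Measurable (I.restrict (π := fun _ => ℝ) : (Fin m → ℝ) → _) :=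
    Finset.measurable_restrict _
  ext s hs
  have hs' := measurable_glue I hs
  have key := congrArg (fun ν : Measure (((Iᶜ : Finset (Fin m)) → ℝ) × (I → ℝ)) =>
    ν ((fun w => glue I w.1 w.2) ⁻¹' s))
    (compProd_map_condDistrib (X := Iᶜ.restrict (π := fun _ => ℝ)) (μ := π) hY.aemeasurable)
  rw [Measure.compProd_apply hs', lintegral_map (Kernel.measurable_kernel_prodMk_left hs') hX,
    Measure.map_apply (hX.prodMk hY) hs'] at key
  rw [Measure.bind_apply hs (Kernel.aemeasurable _)]
  have : ∀ x, gibbsUpdate π I x s = condDistrib (I.restrict (π := fun _ => ℝ))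
      (Iᶜ.restrict (π := fun _ => ℝ)) π (Iᶜ.restrict (π := fun _ => ℝ) x)
      (Prod.mk (Iᶜ.restrict (π := fun _ => ℝ) x) ⁻¹' ((fun w : ((Iᶜ : Finset (Fin m)) → ℝ) ×
        (I → ℝ) => glue I w.1 w.2) ⁻¹' s)) := fun x => by
    rw [gibbsUpdate_apply, Measure.map_apply _ hs]
    · rfl
    · exact measurable_glue_right I _
  simp_rw [this]
  rw [key]
  congr 1
  ext x
  simp [glue_restrict]

/-- Integrating against the regular conditional law is conditional expectation given the outside
coordinates, which on `L²` is the projection `gibbsOp`. -/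
theorem represents_gibbsUpdate (I : Finset (Fin m)) :
    Represents π (gibbsUpdate π I) (gibbsOp π I) := by
  refine ⟨gibbsUpdate_invariant π I, fun φ => ?_⟩
  have hX : Measurable (Iᶜ.restrict (π := fun _ => ℝ) : (Fin m → ℝ) → _) :=
    Finset.measurable_restrict _
  have hY : Measurable (I.restrict (π := fun _ => ℝ) : (Fin m → ℝ) → _) :=
    Finset.measurable_restrict _
  have h := condExp_prod_ae_eq_integral_condDistrib (μ := π) hX hY.aemeasurable
    (f := fun w => φ (glue I w.1 w.2)) ((Lp.stronglyMeasurable φ).comp_measurable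
      (measurable_glue I))
    (by simp only [glue_restrict]; exact (Lp.memLp φ).integrable (by norm_num))
  simp only [glue_restrict] at h
  filter_upwards [gibbsOp_ae_eq π I φ, h] with x h1 h2
  rw [h1, outsideBlock, h2, gibbsUpdate_apply, integral_map]
  · exact (measurable_glue_right I _).aemeasurable
  · exact (Lp.stronglyMeasurable φ).aestronglyMeasurable

variable {π}

/-- `B x` is a prediction of `x` from the coordinates outside the block `I`, and its error is
independent of these coordinates. -/
structure IsPrediction (π : Measure (Fin m → ℝ)) (I : Finset (Fin m))
    (B : (Fin m → ℝ) →ₗ[ℝ] (Fin m → ℝ)) : Prop where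
  congr : ∀ x y : Fin m → ℝ, (∀ i, i ∉ I → x i = y i) → B x = B y
  indep : IndepFun (Iᶜ.restrict (π := fun _ => ℝ)) (fun x => x - B x) π

/-- Independence makes the conditional law of the error `x - B x` a constant kernel, while `B x` is
known from the conditioning; only the error is averaged. -/
theorem IsPrediction.condExp_ae_eq {I : Finset (Fin m)} {B : (Fin m → ℝ) →ₗ[ℝ] (Fin m → ℝ)}
    (hB : IsPrediction π I B) {f : (Fin m → ℝ) → ℝ} (hf : StronglyMeasurable f)
    (hfi : Integrable f π) :
    π[f | outsideBlock I] =ᵐ[π] fun x => ∫ r, f (B x + r) ∂(π.map fun x => x - B x) := by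
  have hX : Measurable (Iᶜ.restrict (π := fun _ => ℝ) : (Fin m → ℝ) → _) :=
    Finset.measurable_restrict _
  have hBm : Measurable B := B.continuous_of_finiteDimensional.measurable
  have hR : Measurable fun x : Fin m → ℝ => x - B x := measurable_id.sub hBm
  have : IsProbabilityMeasure (π.map fun x => x - B x) :=
    Measure.isProbabilityMeasure_map hR.aemeasurable
  -- `B` ignores the coordinates in `I`, so they can be filled with zeros; this exhibits `B x` as a
  -- function of the outside coordinates.
  have hBX : ∀ x, B (glue I (Iᶜ.restrict (π := fun _ => ℝ) x) 0) = B x := fun x =>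
    hB.congr _ _ fun i hi => by simp [glue, hi]
  have hF : Measurable fun w : ((Iᶜ : Finset (Fin m)) → ℝ) × (Fin m → ℝ) =>
      B (glue I w.1 0) + w.2 :=
    (hBm.comp ((measurable_glue I).comp (measurable_fst.prodMk measurable_const))).add
      measurable_snd
  have h := condExp_prod_ae_eq_integral_condDistrib (μ := π) hX hR.aemeasurable
    (f := fun w => f (B (glue I w.1 0) + w.2)) (hf.comp_measurable hF)
    (by simpa only [hBX, add_sub_cancel] using hfi)
  simp only [hBX, add_sub_cancel] at h
  have hcd : condDistrib (fun x => x - B x) (Iᶜ.restrict (π := fun _ => ℝ)) π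
      =ᵐ[π.map (Iᶜ.restrict (π := fun _ => ℝ))] Kernel.const _ (π.map fun x => x - B x) := by
    refine condDistrib_ae_eq_of_measure_eq_compProd _ hR.aemeasurable ?_
    rw [Measure.compProd_const]
    exact (indepFun_iff_map_prod_eq_prod_map_map hX.aemeasurable hR.aemeasurable).1 hB.indep
  filter_upwards [h, ae_of_ae_map hX.aemeasurable hcd] with x h1 h2
  rw [outsideBlock, h1, h2, Kernel.const_apply]

/-- The class `φ` has a Lipschitz representative, with increments controlled by `N`. -/
def HasModulus (N : (Fin m → ℝ) → ℝ) (φ : Lp ℝ 2 π) : Prop :=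
  ∃ f : (Fin m → ℝ) → ℝ, (∃ K, LipschitzWith K f) ∧ (∀ x y, |f x - f y| ≤ N (x - y)) ∧ φ =ᵐ[π] f

/-- The class `φ` has an affine representative with linear part `ℓ`. -/
def IsAffineClass (ℓ : (Fin m → ℝ) →ₗ[ℝ] ℝ) (φ : Lp ℝ 2 π) : Prop :=
  ∃ b : ℝ, φ =ᵐ[π] fun x => ℓ x + b

omit [IsProbabilityMeasure π] in
theorem HasModulus.mono {N N' : (Fin m → ℝ) → ℝ} {φ : Lp ℝ 2 π} (h : HasModulus N φ)
    (hN : ∀ v, N v ≤ N' v) : HasModulus N' φ := by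
  obtain ⟨f, hK, hf, hφ⟩ := h
  exact ⟨f, hK, fun x y => (hf x y).trans (hN _), hφ⟩

theorem LipschitzWith.integrable_of_integrable_id {ν : Measure (Fin m → ℝ)}
    [IsFiniteMeasure ν] (hν : Integrable id ν) {f : (Fin m → ℝ) → ℝ} {K : NNReal}
    (hf : LipschitzWith K f) : Integrable f ν := by
  refine Integrable.mono' ((hν.norm.const_mul (K : ℝ)).add (integrable_const |f 0|))
    hf.continuous.aestronglyMeasurable (Filter.Eventually.of_forall fun x => ?_)
  have := hf.dist_le_mul x 0
  rw [dist_zero_right, Real.dist_eq] at this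
  have h2 : |f x| ≤ |f x - f 0| + |f 0| := by simpa using abs_add_le (f x - f 0) (f 0)
  simp only [Real.norm_eq_abs, Pi.add_apply, id]
  linarith

omit [IsProbabilityMeasure π] in
theorem integrable_id_map_sub (hπ : Integrable id π) (B : (Fin m → ℝ) →ₗ[ℝ] (Fin m → ℝ)) :
    Integrable id (π.map fun x => x - B x) := by
  have hBc : Continuous B := B.continuous_of_finiteDimensional
  rw [integrable_map_measure (by fun_prop) (by fun_prop)]
  exact hπ.sub ((B.toContinuousLinearMap).integrable_comp hπ)

/-- In the representative `x ↦ E f(B x + R)` the noise cancels from the increments, which therefore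
see only `B (x - y)`. -/
theorem IsPrediction.hasModulus (hπ : Integrable id π) {I : Finset (Fin m)}
    {B : (Fin m → ℝ) →ₗ[ℝ] (Fin m → ℝ)} (hB : IsPrediction π I B) {N : (Fin m → ℝ) → ℝ}
    {φ : Lp ℝ 2 π} (h : HasModulus N φ) :
    HasModulus (fun v => N (B v)) (gibbsOp π I φ) := by
  obtain ⟨f, ⟨K, hK⟩, hN, hφ⟩ := h
  have hBc : Continuous B := B.continuous_of_finiteDimensional
  have hR : Measurable fun x : Fin m → ℝ => x - B x := (continuous_id.sub hBc).measurable
  set ν := π.map fun x => x - B x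
  have : IsProbabilityMeasure ν := Measure.isProbabilityMeasure_map hR.aemeasurable
  have hint : ∀ a, Integrable (fun r => f (a + r)) ν := fun a =>
    LipschitzWith.integrable_of_integrable_id (integrable_id_map_sub hπ B)
      (K := K * 1) (hK.comp (LipschitzWith.of_dist_le_mul fun x y => by simp))
  have hdiff : ∀ x y D, (∀ r, |f (B x + r) - f (B y + r)| ≤ D) →
      |∫ r, f (B x + r) ∂ν - ∫ r, f (B y + r) ∂ν| ≤ D := fun x y D hD => by
    rw [← integral_sub (hint _) (hint _)]
    have := norm_integral_le_of_norm_le_const (μ := ν)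
      (f := fun r => f (B x + r) - f (B y + r)) (Filter.Eventually.of_forall hD)
    simpa using this
  refine ⟨fun x => ∫ r, f (B x + r) ∂ν, ⟨K * ‖B.toContinuousLinearMap‖₊, ?_⟩, ?_, ?_⟩
  · refine LipschitzWith.of_dist_le_mul fun x y => ?_
    rw [Real.dist_eq]
    refine hdiff x y _ fun r => ?_
    rw [← Real.dist_eq]
    refine (hK.dist_le_mul _ _).trans ?_
    rw [dist_add_right, NNReal.coe_mul, mul_assoc]
    gcongr
    exact B.toContinuousLinearMap.lipschitz.dist_le_mul x y
  · intro x y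
    refine hdiff x y _ fun r => ?_
    have := hN (B x + r) (B y + r)
    rwa [add_sub_add_right_eq_sub, ← map_sub] at this
  · have hfi : Integrable f π := LipschitzWith.integrable_of_integrable_id hπ hK
    exact (gibbsOp_ae_eq π I φ).trans ((condExp_congr_ae hφ).trans
      (hB.condExp_ae_eq hK.continuous.stronglyMeasurable hfi))

/-- Averaging over the noise changes only the constant term. -/
theorem IsPrediction.isAffineClass (hπ : Integrable id π) {I : Finset (Fin m)}
    {B : (Fin m → ℝ) →ₗ[ℝ] (Fin m → ℝ)} (hB : IsPrediction π I B)
    {ℓ : (Fin m → ℝ) →ₗ[ℝ] ℝ} {φ : Lp ℝ 2 π} (h : IsAffineClass ℓ φ) :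
    IsAffineClass (ℓ ∘ₗ B) (gibbsOp π I φ) := by
  obtain ⟨b, hφ⟩ := h
  have hBc : Continuous B := B.continuous_of_finiteDimensional
  have hℓc : Continuous ℓ := ℓ.continuous_of_finiteDimensional
  have hR : Measurable fun x : Fin m → ℝ => x - B x := (continuous_id.sub hBc).measurable
  set ν := π.map fun x => x - B x
  have : IsProbabilityMeasure ν := Measure.isProbabilityMeasure_map hR.aemeasurable
  have hℓν : Integrable ℓ ν :=
    ℓ.toContinuousLinearMap.integrable_comp (integrable_id_map_sub hπ B)
  have hℓπ : Integrable ℓ π := ℓ.toContinuousLinearMap.integrable_comp hπ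
  refine ⟨∫ r, ℓ r ∂ν + b, (gibbsOp_ae_eq π I φ).trans ((condExp_congr_ae hφ).trans
    ((hB.condExp_ae_eq (f := fun x => ℓ x + b)
      (hℓc.add continuous_const).stronglyMeasurable (hℓπ.add (integrable_const b))).trans ?_))⟩
  filter_upwards with x
  simp only [map_add, LinearMap.comp_apply]
  have e : (fun r => ℓ (B x) + ℓ r + b) = fun r => ℓ r + (ℓ (B x) + b) := by ext r; ring
  rw [e, integral_add hℓν (integrable_const _)]
  simp
  ring

end GibbsOperator

/-! ### From Lipschitz contraction to decay in `L²` -/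

section Adjoint

variable {H : Type*} [NormedAddCommGroup H] [InnerProductSpace ℝ H]

theorem inner_pow_apply {T T' : H →L[ℝ] H} (h : ∀ x y, inner ℝ (T x) y = inner ℝ x (T' y))
    (n : ℕ) (x y : H) : inner ℝ ((T ^ n) x) y = inner ℝ x ((T' ^ n) y) := by
  induction n generalizing x y with
  | zero => rfl
  | succ n ih =>
    rw [pow_succ, pow_succ']
    change inner ℝ ((T ^ n) (T x)) y = inner ℝ x (T' ((T' ^ n) y))
    rw [ih, h]

theorem inner_list_prod_apply {ι : Type*} {T : ι → H →L[ℝ] H}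
    (h : ∀ i x y, inner ℝ (T i x) y = inner ℝ x (T i y)) (l : List ι) (x y : H) :
    inner ℝ ((l.map T).prod x) y = inner ℝ x ((l.reverse.map T).prod y) := by
  induction l generalizing x y with
  | nil => simp
  | cons i l ih =>
    simp only [List.map_cons, List.prod_cons, List.reverse_cons, List.map_append, List.prod_append,
      List.map_nil, List.prod_nil, mul_one]
    change inner ℝ (T i ((l.map T).prod x)) y = inner ℝ x ((l.reverse.map T).prod (T i y))
    rw [h, ih]

theorem list_prod_apply_eq_self {ι : Type*} {T : ι → H →L[ℝ] H} {e : H} (h : ∀ i, T i e = e)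
    (l : List ι) : (l.map T).prod e = e := by
  induction l with
  | nil => rfl
  | cons i l ih =>
    simp only [List.map_cons, List.prod_cons]
    change T i ((l.map T).prod e) = e
    rw [ih, h]

theorem pow_apply_eq_self {T : H →L[ℝ] H} {e : H} (h : T e = e) (n : ℕ) : (T ^ n) e = e := by
  induction n with
  | zero => rfl
  | succ n ih => rw [pow_succ]; change (T ^ n) (T e) = e; rw [h, ih]

end Adjoint

section Criteria

variable {m : ℕ} {π : Measure (Fin m → ℝ)} [IsProbabilityMeasure π]

theorem HasModulus.sub_const {N : (Fin m → ℝ) → ℝ} {φ : Lp ℝ 2 π} (h : HasModulus N φ) (a : ℝ) :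
    HasModulus N (φ - a • oneLp π) := by
  obtain ⟨f, ⟨K, hK⟩, hf, hφ⟩ := h
  refine ⟨fun x => f x - a, ⟨K, ?_⟩, fun x y => by simpa using hf x y, ?_⟩
  · exact LipschitzWith.of_dist_le_mul fun x y => by simpa using hK.dist_le_mul x y
  · filter_upwards [hφ, coeFn_oneLp (π := π), Lp.coeFn_sub φ (a • oneLp π),
      Lp.coeFn_smul a (oneLp π)] with x h1 h2 h3 h4
    rw [h3, Pi.sub_apply, h4, Pi.smul_apply, h1, h2]; simp

/-- A centred function is `f x = ∫ (f x - f y) dπ(y)`, hence at most `L (‖x‖ + E‖y‖)`; `A` is the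
`L²`-norm of this bound without `L`. -/
theorem HasModulus.norm_le (hπ : MemLp id 2 π) : ∃ A : ℝ, 0 ≤ A ∧ ∀ (L : ℝ) (φ : Lp ℝ 2 π),
    0 ≤ L → HasModulus (fun v => L * ‖v‖) φ → inner ℝ (oneLp π) φ = 0 → ‖φ‖ ≤ L * A := by
  have hint : Integrable id π := hπ.integrable (by norm_num)
  have hψ : MemLp (fun x : Fin m → ℝ => ‖x‖ + ∫ y, ‖y‖ ∂π) 2 π := hπ.norm.add (memLp_const _)
  refine ⟨‖hψ.toLp‖, norm_nonneg _, fun L φ hL ⟨f, ⟨K, hK⟩, hf, hφ⟩ h0 => ?_⟩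
  refine Lp.norm_le_mul_norm_of_ae_le_mul ?_
  rw [inner_oneLp, integral_congr_ae hφ] at h0
  have hfi : Integrable f π := LipschitzWith.integrable_of_integrable_id hint hK
  filter_upwards [hφ, hψ.coeFn_toLp] with x h1 h2
  rw [h1, h2]
  have hn : Integrable (fun y : Fin m → ℝ => ‖y‖) π := hint.norm
  have e : f x = ∫ y, (f x - f y) ∂π := by
    rw [integral_sub (integrable_const _) hfi, h0]; simp
  have hpos : 0 ≤ ‖x‖ + ∫ y, ‖y‖ ∂π :=
    add_nonneg (norm_nonneg _) (integral_nonneg fun _ => norm_nonneg _)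
  rw [Real.norm_of_nonneg hpos, e]
  refine (norm_integral_le_integral_norm _).trans ?_
  have e2 : L * (‖x‖ + ∫ y, ‖y‖ ∂π) = ∫ y, L * (‖x‖ + ‖y‖) ∂π := by
    rw [integral_const_mul, integral_add (integrable_const _) hn]; simp
  rw [e2]
  refine integral_mono ((integrable_const _).sub hfi).norm
    (((integrable_const _).add hn).const_mul L) fun y => ?_
  exact (hf x y).trans (mul_le_mul_of_nonneg_left (norm_sub_le x y) hL)

/-- Compactly supported smooth functions are Lipschitz and dense. -/
theorem dense_hasModulus :
    Dense {φ : Lp ℝ 2 π | ∃ L : ℝ, 0 ≤ L ∧ HasModulus (fun v => L * ‖v‖) φ} := by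
  refine (Lp.dense_hasCompactSupport_contDiff (F := ℝ) (μ := π) (p := 2) (by norm_num)).mono ?_
  rintro φ ⟨g, hφ, hg1, hg2⟩
  obtain ⟨K, hK⟩ := hg2.lipschitzWith_of_hasCompactSupport hg1 (by simp)
  exact ⟨K, K.2, g, ⟨K, hK⟩, fun x y => by
    simpa [Real.dist_eq, dist_eq_norm] using hK.dist_le_mul x y, hφ⟩

/-- If an operator and its adjoint contract Lipschitz constants, up to a factor `C`, at rate `ρ`,
then the operator contracts the centred part of `L²` at that rate. -/
theorem norm_pow_apply_sub_le (hπ : MemLp id 2 π) {T T' : Lp ℝ 2 π →L[ℝ] Lp ℝ 2 π}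
    (hT : ∀ x y, inner ℝ (T x) y = inner ℝ x (T' y)) (he : T (oneLp π) = oneLp π)
    (he' : T' (oneLp π) = oneLp π) {C ρ : ℝ} (hC : 0 ≤ C) (hρ : 0 ≤ ρ)
    (h : ∀ (n : ℕ) (L : ℝ) (φ : Lp ℝ 2 π), 0 ≤ L → HasModulus (fun v => L * ‖v‖) φ →
      HasModulus (fun v => C * ρ ^ n * L * ‖v‖) ((T ^ n) φ))
    (h' : ∀ (n : ℕ) (L : ℝ) (φ : Lp ℝ 2 π), 0 ≤ L → HasModulus (fun v => L * ‖v‖) φ →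
      HasModulus (fun v => C * ρ ^ n * L * ‖v‖) ((T' ^ n) φ)) (n : ℕ) (φ : Lp ℝ 2 π) :
    ‖(T ^ n) φ - inner ℝ (oneLp π) φ • oneLp π‖ ≤
      C * ρ ^ n * ‖φ - inner ℝ (oneLp π) φ • oneLp π‖ := by
  have hTn := inner_pow_apply hT n
  have hen := pow_apply_eq_self he n
  have hen' := pow_apply_eq_self he' n
  have ha : 0 ≤ C * ρ ^ n := by positivity
  refine norm_apply_sub_le_of_dense (T ^ n) (T' ^ n) hTn hen dense_hasModulus ha ?_ φ
  rintro g ⟨L, hL, hg⟩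
  obtain ⟨A, hA, hnorm⟩ := HasModulus.norm_le hπ
  set g0 := g - inner ℝ (oneLp π) g • oneLp π with hg0
  have hg0mod : HasModulus (fun v => L * ‖v‖) g0 := hg.sub_const _
  have hg0mean : inner ℝ (oneLp π) g0 = 0 := by
    rw [hg0, inner_sub_right, inner_smul_right, real_inner_self_eq_norm_sq, norm_oneLp]; simp
  -- Each round trip through `Tⁿ` and `T'ⁿ` costs the factor `(C ρⁿ)²` in the Lipschitz constant and
  -- keeps the mean zero, which is the orbit growth required for `a = C ρⁿ`.
  have step : ∀ k : ℕ, HasModulus (fun v => ((C * ρ ^ n) ^ 2) ^ k * L * ‖v‖)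
      (((T' ^ n * T ^ n) ^ k) g0) ∧ inner ℝ (oneLp π) (((T' ^ n * T ^ n) ^ k) g0) = 0 := by
    intro k
    induction k with
    | zero => simpa using ⟨hg0mod, hg0mean⟩
    | succ k ih =>
      have e : ((T' ^ n * T ^ n) ^ (k + 1)) g0
          = (T' ^ n) ((T ^ n) (((T' ^ n * T ^ n) ^ k) g0)) := by rw [pow_succ']; rfl
      rw [e]
      constructor
      · refine (h' n _ _ (by positivity) (h n _ _ (by positivity) ih.1)).mono fun v => le_of_eq ?_
        ring
      · rw [← hTn, hen, ← real_inner_comm, hTn, hen', real_inner_comm]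
        exact ih.2
  refine ⟨L * A, fun k => (hnorm _ _ (by positivity) (step k).1 (step k).2).trans (le_of_eq ?_)⟩
  ring

/-- A lower bound for the decay of affine functions. -/
theorem exists_le_norm_pow_apply_sub {T : Lp ℝ 2 π →L[ℝ] Lp ℝ 2 π} (hπ : MemLp id 2 π)
    {M : (Fin m → ℝ) →ₗ[ℝ] (Fin m → ℝ)}
    (hM : ∀ ℓ φ, IsAffineClass ℓ φ → IsAffineClass (ℓ ∘ₗ M) (T φ)) {v : Fin m → ℝ} {ρ : ℝ}
    (hv : v ≠ 0) (hMv : M v = ρ • v) {ψ : Lp ℝ 2 π} (hψ0 : inner ℝ (oneLp π) ψ = 0)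
    (hψ : ∀ ℓ (φ : Lp ℝ 2 π), IsAffineClass ℓ φ → inner ℝ φ ψ = ℓ v) :
    ∃ (φ : Lp ℝ 2 π) (A : ℝ), 0 < A ∧ ∀ n : ℕ,
      A * ρ ^ n ≤ ‖(T ^ n) φ - inner ℝ (oneLp π) φ • oneLp π‖ := by
  obtain ⟨i, hi⟩ : ∃ i, v i ≠ 0 := Function.ne_iff.1 hv
  -- A coordinate on which `v` does not vanish, normalised so that `ℓ v = 1`.
  let ℓ : (Fin m → ℝ) →ₗ[ℝ] ℝ := (v i)⁻¹ • LinearMap.proj i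
  have hℓv : ℓ v = 1 := by simp [ℓ, hi]
  have hmem : MemLp ℓ 2 π := ℓ.toContinuousLinearMap.comp_memLp' hπ
  have haff : IsAffineClass ℓ hmem.toLp := ⟨0, by simpa using hmem.coeFn_toLp⟩
  have hpow : ∀ n : ℕ, ∃ ℓ' : (Fin m → ℝ) →ₗ[ℝ] ℝ, ℓ' v = ρ ^ n ∧
      IsAffineClass ℓ' ((T ^ n) hmem.toLp) := by
    intro n
    induction n with
    | zero => exact ⟨ℓ, by simpa using hℓv, haff⟩
    | succ n ih =>
      obtain ⟨ℓ', h1, h2⟩ := ih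
      refine ⟨ℓ' ∘ₗ M, by simp [hMv, h1, pow_succ, mul_comm], ?_⟩
      rw [pow_succ']
      exact hM _ _ h2
  -- Cauchy–Schwarz against `ψ`; the subtracted mean is invisible because `ψ` is orthogonal to
  -- constants.
  have key : ∀ n : ℕ, ρ ^ n ≤ ‖(T ^ n) hmem.toLp -
      inner ℝ (oneLp π) hmem.toLp • oneLp π‖ * ‖ψ‖ := fun n => by
    obtain ⟨ℓ', h1, h2⟩ := hpow n
    rw [← h1, ← hψ _ _ h2]
    refine le_trans (le_of_eq ?_) (real_inner_le_norm _ _)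
    rw [inner_sub_left, inner_smul_left, hψ0]; simp
  -- The case `n = 0` of `key` reads `1 ≤ ⋯ * ‖ψ‖`, which excludes `ψ = 0`.
  have hψpos : 0 < ‖ψ‖ := by
    refine (norm_nonneg _).lt_of_ne fun h0 => ?_
    have := key 0
    rw [← h0] at this
    norm_num at this
  refine ⟨hmem.toLp, ‖ψ‖⁻¹, by positivity, fun n => ?_⟩
  rw [inv_mul_le_iff₀ hψpos, mul_comm]
  exact key n

end Criteria

/-! ### Spectral theory of the path and of resampling -/

section Path

variable {m : ℕ}

/-- The adjacency matrix of the path `0 - 1 - ⋯ - (m - 1)`. -/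
def pathAdj (m : ℕ) : Matrix (Fin m) (Fin m) ℝ :=
  Matrix.of fun i j => if (i : ℕ) + 1 = j ∨ (j : ℕ) + 1 = i then 1 else 0

theorem pathAdj_comm (i j : Fin m) : pathAdj m i j = pathAdj m j i := by
  simp [pathAdj, or_comm]

theorem pathAdj_nonneg (i j : Fin m) : 0 ≤ pathAdj m i j := by
  simp only [pathAdj, Matrix.of_apply]; split_ifs <;> norm_num

theorem pathAdj_eq_zero {i j : Fin m} (h : ¬((i : ℕ) + 1 = j ∨ (j : ℕ) + 1 = i)) :
    pathAdj m i j = 0 := by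
  simp [pathAdj, h]

/-- Shifting the index by one puts the missing neighbours of the two end vertices at `0` and `m +
1`, where `g` vanishes, so all vertices obey the same formula. -/
theorem pathAdj_mulVec_apply (g : ℕ → ℝ) (h0 : g 0 = 0) (hm : g (m + 1) = 0) (j : Fin m) :
    (pathAdj m).mulVec (fun i => g (i + 1)) j = g j + g (j + 2) := by
  have e : ∀ k : Fin m, pathAdj m j k * g (k + 1) =
      (if (k : ℕ) + 1 = j then g (k + 1) else 0) + if (j : ℕ) + 1 = k then g (k + 1) else 0 := by
    intro k
    simp only [pathAdj, Matrix.of_apply]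
    split_ifs <;> first | omega | simp
  have h1 : ∑ k : Fin m, (if (k : ℕ) + 1 = j then g (k + 1) else 0) = g j := by
    by_cases hj : (j : ℕ) = 0
    · rw [Finset.sum_eq_zero fun k _ => if_neg (by omega), hj, h0]
    · rw [Finset.sum_eq_single (⟨j - 1, by omega⟩ : Fin m)]
      · rw [if_pos (by simp; omega)]; congr 1; simp; omega
      · intro b _ hb
        exact if_neg fun h => hb (Fin.ext (by simp; omega))
      · simp
  have h2 : ∑ k : Fin m, (if (j : ℕ) + 1 = k then g (k + 1) else 0) = g (j + 2) := by
    by_cases hj : (j : ℕ) + 1 = m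
    · rw [Finset.sum_eq_zero fun k _ => if_neg (by omega), show (j : ℕ) + 2 = m + 1 by omega, hm]
    · rw [Finset.sum_eq_single (⟨j + 1, by omega⟩ : Fin m)]
      · rw [if_pos (by simp)]
      · intro b _ hb
        exact if_neg fun h => hb (Fin.ext (by simp; omega))
      · simp
  simp only [Matrix.mulVec, dotProduct]
  rw [Finset.sum_congr rfl fun k _ => e k, Finset.sum_add_distrib, h1, h2]

/-- The sine wave on the path, with sign pattern `εⁱ`. -/
noncomputable def wave (m : ℕ) (ε : ℝ) (i : Fin m) : ℝ :=
  ε ^ ((i : ℕ) + 1) * Real.sin (((i : ℕ) + 1 : ℕ) * (Real.pi / (m + 1)))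

/-- The largest eigenvalue of `c` times the adjacency matrix of the path. -/
noncomputable def pathTop (m : ℕ) (c : ℝ) : ℝ := 2 * |c| * Real.cos (Real.pi / (m + 1))

/-- With `θ = π/(m+1)`, the identity `sin jθ + sin (j+2)θ = 2 cos θ sin (j+1)θ` gives the
eigenvalue, and `sin 0 = sin π = 0` the boundary values. The path is bipartite, so the alternating
signs `εⁱ` turn `c` into `|c|`. -/
theorem mul_pathAdj_mulVec_wave {c ε : ℝ} (hε : ε * ε = 1) (hc : c * ε = |c|) (j : Fin m) :
    c * (pathAdj m).mulVec (wave m ε) j = pathTop m c * wave m ε j := by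
  have h := pathAdj_mulVec_apply (m := m)
    (fun n => ε ^ n * Real.sin ((n : ℝ) * (Real.pi / (m + 1)))) (by simp) (by
      have : ((m + 1 : ℕ) : ℝ) * (Real.pi / (m + 1)) = Real.pi := by
        push_cast; field_simp
      rw [this, Real.sin_pi, mul_zero]) j
  change c * (pathAdj m).mulVec (fun i => _) j = _
  simp only [wave] at h ⊢
  rw [h, pathTop, ← hc]
  set θ := Real.pi / ((m : ℝ) + 1)
  have e1 : Real.sin ((j : ℕ) * θ) = Real.sin (((j : ℕ) + 1 : ℕ) * θ) * Real.cos θ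
      - Real.cos (((j : ℕ) + 1 : ℕ) * θ) * Real.sin θ := by
    rw [← Real.sin_sub]; congr 1; push_cast; ring
  have e2 : Real.sin (((j : ℕ) + 2 : ℕ) * θ) = Real.sin (((j : ℕ) + 1 : ℕ) * θ) * Real.cos θ
      + Real.cos (((j : ℕ) + 1 : ℕ) * θ) * Real.sin θ := by
    rw [← Real.sin_add]; congr 1; push_cast; ring
  rw [e1, e2]
  have e3 : ε ^ ((j : ℕ) + 2) = ε ^ (j : ℕ) := by rw [pow_add, pow_two, hε, mul_one]
  rw [e3]
  have e4 : ε * ε ^ ((j : ℕ) + 1) = ε ^ (j : ℕ) := by rw [pow_succ', ← mul_assoc, hε, one_mul]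
  rw [show 2 * (c * ε) * Real.cos θ * (ε ^ ((j : ℕ) + 1) * Real.sin (((j : ℕ) + 1 : ℕ) * θ))
    = 2 * c * Real.cos θ * (ε * ε ^ ((j : ℕ) + 1)) * Real.sin (((j : ℕ) + 1 : ℕ) * θ) by ring, e4]
  ring

theorem wave_one_pos (i : Fin m) : 0 < wave m 1 i := by
  rw [wave, one_pow, one_mul]
  refine Real.sin_pos_of_pos_of_lt_pi (by positivity) ?_
  rw [← mul_div_assoc, div_lt_iff₀ (by positivity), mul_comm]
  have : (((i : ℕ) + 1 : ℕ) : ℝ) < m + 1 := by exact_mod_cast Nat.succ_lt_succ i.2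
  exact mul_lt_mul_of_pos_left this Real.pi_pos

theorem wave_ne_zero (i : Fin m) {ε : ℝ} (hε : ε * ε = 1) : wave m ε i ≠ 0 := by
  have h := (wave_one_pos i).ne'
  simp only [wave, one_pow, one_mul] at h ⊢
  exact mul_ne_zero (pow_ne_zero _ fun h0 => by simp [h0] at hε) h

theorem exists_sign (c : ℝ) : ∃ ε : ℝ, ε * ε = 1 ∧ c * ε = |c| := by
  rcases le_total 0 c with h | h
  · exact ⟨1, by norm_num, by rw [abs_of_nonneg h, mul_one]⟩
  · exact ⟨-1, by norm_num, by rw [abs_of_nonpos h]; ring⟩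

theorem pathTop_nonneg (hm : 1 ≤ m) (c : ℝ) : 0 ≤ pathTop m c := by
  have h1 : (1 : ℝ) ≤ m := by exact_mod_cast hm
  have : 0 ≤ Real.cos (Real.pi / (m + 1)) := by
    refine Real.cos_nonneg_of_neg_pi_div_two_le_of_le ?_ ?_
    · have : 0 ≤ Real.pi / (m + 1) := by positivity
      linarith [Real.pi_pos]
    · exact div_le_div_of_nonneg_left Real.pi_pos.le (by norm_num) (by linarith)
  unfold pathTop
  positivity

theorem pathTop_abs (c : ℝ) : pathTop m |c| = pathTop m c := by simp [pathTop]

/-- A nonnegative row that annihilates the positive wave is zero. This settles the degenerate case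
`γ = 0`, where damping by powers of `γ` is useless. -/
theorem mul_pathAdj_mulVec_eq_zero {c : ℝ} (h : pathTop m c = 0) (v : Fin m → ℝ)
    (j : Fin m) : c * (pathAdj m).mulVec v j = 0 := by
  have hw := mul_pathAdj_mulVec_wave (m := m) (c := |c|) (ε := 1) (by norm_num) (by simp)
  rcases eq_or_ne c 0 with rfl | hc
  · simp
  have hzero : ∀ k, pathAdj m j k = 0 := by
    have := hw j
    rw [pathTop_abs, h, zero_mul, mul_eq_zero] at this
    have hs := this.resolve_left (abs_ne_zero.2 hc)
    simp only [Matrix.mulVec, dotProduct] at hs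
    rw [Finset.sum_eq_zero_iff_of_nonneg fun k _ =>
      mul_nonneg (pathAdj_nonneg _ _) (wave_one_pos k).le] at hs
    exact fun k => (mul_eq_zero.1 (hs k (Finset.mem_univ k))).resolve_right (wave_one_pos k).ne'
  simp [Matrix.mulVec, dotProduct, hzero]

/-- Replace the coordinates in the block `I` by `c` times the sum of their neighbours. -/
def resample (c : ℝ) (I : Finset (Fin m)) : (Fin m → ℝ) →ₗ[ℝ] (Fin m → ℝ) where
  toFun v j := if j ∈ I then c * (pathAdj m).mulVec v j else v j
  map_add' v w := by
    ext j; simp only [Matrix.mulVec_add, Pi.add_apply]; split_ifs <;> ring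
  map_smul' a v := by
    ext j
    simp only [Matrix.mulVec_smul, Pi.smul_apply, smul_eq_mul, RingHom.id_apply]
    split_ifs <;> ring

theorem resample_apply (c : ℝ) (I : Finset (Fin m)) (v : Fin m → ℝ) (j : Fin m) :
    resample c I v j = if j ∈ I then c * (pathAdj m).mulVec v j else v j := rfl

/-- Resample the blocks of a list one after the other. -/
def resampleList (c : ℝ) : List (Finset (Fin m)) → (Fin m → ℝ) →ₗ[ℝ] (Fin m → ℝ)
  | [] => LinearMap.id
  | I :: l => resampleList c l ∘ₗ resample c I

/-- The adjacency matrix is nonnegative, so replacing `c` by `|c|` dominates entrywise and reduces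
norm bounds to positive operators. -/
theorem abs_resample_le {c : ℝ} {I : Finset (Fin m)} {v u : Fin m → ℝ} (h : ∀ j, |v j| ≤ u j)
    (j : Fin m) : |resample c I v j| ≤ resample |c| I u j := by
  rw [resample_apply, resample_apply]
  split_ifs
  · rw [abs_mul]
    simp only [Matrix.mulVec, dotProduct]
    refine mul_le_mul_of_nonneg_left ((Finset.abs_sum_le_sum_abs _ _).trans ?_) (abs_nonneg c)
    refine Finset.sum_le_sum fun k _ => ?_
    rw [abs_mul, abs_of_nonneg (pathAdj_nonneg j k)]
    exact mul_le_mul_of_nonneg_left (h k) (pathAdj_nonneg j k)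
  · exact h j

theorem abs_resampleList_le {c : ℝ} (l : List (Finset (Fin m))) {v u : Fin m → ℝ}
    (h : ∀ j, |v j| ≤ u j) (j : Fin m) : |resampleList c l v j| ≤ resampleList |c| l u j := by
  induction l generalizing v u with
  | nil => exact h j
  | cons I l ih => exact ih (abs_resample_le h)

theorem abs_resampleList_pow_le {c : ℝ} {l : List (Finset (Fin m))} {w : Fin m → ℝ} {ρ : ℝ}
    (hw : resampleList |c| l w = ρ • w) {v : Fin m → ℝ} {K : ℝ} (h : ∀ j, |v j| ≤ K * w j)
    (n : ℕ) (j : Fin m) : |(resampleList c l ^ n) v j| ≤ K * ρ ^ n * w j := by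
  induction n generalizing j with
  | zero => simpa using h j
  | succ n ih =>
    rw [pow_succ']
    refine (abs_resampleList_le l (u := (K * ρ ^ n) • w) ih j).trans (le_of_eq ?_)
    rw [map_smul, hw]
    simp only [Pi.smul_apply, smul_eq_mul]
    ring

/-- A positive eigenvector of the dominating operator controls all powers in the `w`-weighted sup
norm; the constant compares this norm with the usual one. -/
theorem norm_resampleList_pow_le {c : ℝ} {l : List (Finset (Fin m))} {w : Fin m → ℝ} {ρ : ℝ}
    (hρ : 0 ≤ ρ) (hpos : ∀ j, 0 < w j) (hw : resampleList |c| l w = ρ • w) :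
    ∃ C : ℝ, 0 ≤ C ∧ ∀ (n : ℕ) (v : Fin m → ℝ), ‖(resampleList c l ^ n) v‖ ≤ C * ρ ^ n * ‖v‖ := by
  have h1 : 0 ≤ ∑ j, w j := Finset.sum_nonneg fun j _ => (hpos j).le
  have h2 : 0 ≤ ∑ j, (w j)⁻¹ := Finset.sum_nonneg fun j _ => (inv_pos.2 (hpos j)).le
  refine ⟨(∑ j, (w j)⁻¹) * ∑ j, w j, by positivity, fun n v => ?_⟩
  refine (pi_norm_le_iff_of_nonneg (by positivity)).2 fun j => ?_
  have hb : ∀ j, |v j| ≤ (‖v‖ * ∑ j, (w j)⁻¹) * w j := fun j => by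
    have hle : (w j)⁻¹ ≤ ∑ j, (w j)⁻¹ := Finset.single_le_sum (f := fun j => (w j)⁻¹)
      (fun i _ => (inv_pos.2 (hpos i)).le) (Finset.mem_univ j)
    calc |v j| ≤ ‖v‖ := norm_le_pi_norm v j
      _ = ‖v‖ * (w j)⁻¹ * w j := by rw [mul_assoc, inv_mul_cancel₀ (hpos j).ne', mul_one]
      _ ≤ _ := by have := hpos j; gcongr
  have hle : w j ≤ ∑ j, w j := Finset.single_le_sum (fun i _ => (hpos i).le) (Finset.mem_univ j)
  calc |(resampleList c l ^ n) v j| ≤ (‖v‖ * ∑ j, (w j)⁻¹) * ρ ^ n * w j :=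
        abs_resampleList_pow_le hw hb n j
    _ ≤ (‖v‖ * ∑ j, (w j)⁻¹) * ρ ^ n * ∑ j, w j := by gcongr
    _ = _ := by ring

/-- The sine wave damped by `γʰ`. -/
noncomputable def tiltedWave (m : ℕ) (γ ε : ℝ) (h : Fin m → ℕ) (i : Fin m) : ℝ :=
  γ ^ h i * wave m ε i

/-- Resampling a block below its neighbours raises it by two levels. -/
theorem resample_tiltedWave {c ε : ℝ} (hε : ε * ε = 1) (hc : c * ε = |c|) {I : Finset (Fin m)}
    {h : Fin m → ℕ} (hI : ∀ i ∈ I, ∀ k : Fin m, ((i : ℕ) + 1 = k ∨ (k : ℕ) + 1 = i) →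
      h k = h i + 1) :
    resample c I (tiltedWave m (pathTop m c) ε h) =
      tiltedWave m (pathTop m c) ε (fun i => if i ∈ I then h i + 2 else h i) := by
  ext i
  rw [resample_apply]
  simp only [tiltedWave]
  split_ifs with hi
  · have e : (pathAdj m).mulVec (tiltedWave m (pathTop m c) ε h) i =
        pathTop m c ^ (h i + 1) * (pathAdj m).mulVec (wave m ε) i := by
      simp only [Matrix.mulVec, dotProduct, Finset.mul_sum, tiltedWave]
      refine Finset.sum_congr rfl fun k _ => ?_
      by_cases hk : (i : ℕ) + 1 = k ∨ (k : ℕ) + 1 = i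
      · rw [hI i hi k hk]; ring
      · rw [pathAdj_eq_zero hk]; ring
    change c * (pathAdj m).mulVec (tiltedWave m (pathTop m c) ε h) i = _
    -- One power of the top eigenvalue comes from the level `h i + 1` of the neighbours, the second
    -- from the eigenvalue equation.
    rw [e, mul_left_comm, mul_pathAdj_mulVec_wave hε hc]
    ring
  · rfl

/-- `D` holds the sites already updated, which have been raised by two. When `a` is updated, a later
neighbour still has height `h a + 1`, and an earlier neighbour `d` has `h d + 2`, which is also `h a
+ 1`. -/
theorem resampleList_singleton_tiltedWave_aux {c ε : ℝ} (hε : ε * ε = 1) (hc : c * ε = |c|)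
    {h : Fin m → ℕ} (l : List (Fin m)) (D : Finset (Fin m)) (hl : l.Nodup)
    (hD : ∀ x, x ∈ D ↔ x ∉ l)
    (hp : l.Pairwise fun i k : Fin m => ((i : ℕ) + 1 = k ∨ (k : ℕ) + 1 = i) → h k = h i + 1)
    (hDl : ∀ d ∈ D, ∀ a ∈ l, ((d : ℕ) + 1 = a ∨ (a : ℕ) + 1 = d) → h a = h d + 1) :
    resampleList c (l.map fun i => {i}) (tiltedWave m (pathTop m c) ε
      fun i => if i ∈ D then h i + 2 else h i) =
      tiltedWave m (pathTop m c) ε (fun i => h i + 2) := by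
  induction l generalizing D with
  | nil =>
    have : ∀ x, x ∈ D := fun x => (hD x).2 (by simp)
    simp [resampleList, this]
  | cons a l ih =>
    have haD : a ∉ D := fun h => (hD a).1 h (by simp)
    have hal : a ∉ l := (List.nodup_cons.1 hl).1
    rw [List.map_cons, resampleList, LinearMap.comp_apply, resample_tiltedWave hε hc]
    · have := ih (insert a D) (List.nodup_cons.1 hl).2 (fun x => ?_) (List.pairwise_cons.1 hp).2 ?_
      · convert! this using 3
        ext i
        by_cases hi : i = a
        · subst hi; simp [haD]
        · simp [hi]
      · rw [Finset.mem_insert, hD x, List.mem_cons, not_or]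
        by_cases hx : x = a
        · subst hx; simp [hal]
        · simp [hx]
      · intro d hd b hb hadj
        rcases Finset.mem_insert.1 hd with rfl | hd
        · exact (List.pairwise_cons.1 hp).1 b hb hadj
        · exact hDl d hd b (List.mem_cons_of_mem _ hb) hadj
    · intro i hi k hk
      rw [Finset.mem_singleton.1 hi] at hk ⊢
      rw [if_neg haD]
      by_cases hkD : k ∈ D
      · rw [if_pos hkD]
        have := hDl k hkD a (by simp) hk.symm
        omega
      · rw [if_neg hkD]
        have hkl : k ∈ a :: l := by by_contra hn; exact hkD ((hD k).2 hn)
        rcases List.mem_cons.1 hkl with rfl | hkl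
        · omega
        · exact (List.pairwise_cons.1 hp).1 k hkl hk

theorem tiltedWave_add_two (γ ε : ℝ) (h : Fin m → ℕ) :
    tiltedWave m γ ε (fun i => h i + 2) = γ ^ 2 • tiltedWave m γ ε h := by
  ext i; simp only [tiltedWave, Pi.smul_apply, smul_eq_mul]; ring

/-- One pass over the list `l` of blocks multiplies a tilted wave by the square of the top
eigenvalue. -/
def RaisesWave (l : List (Finset (Fin m))) : Prop :=
  ∃ h : Fin m → ℕ, ∀ c ε : ℝ, ε * ε = 1 → c * ε = |c| →
    resampleList c l (tiltedWave m (pathTop m c) ε h) =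
      pathTop m c ^ 2 • tiltedWave m (pathTop m c) ε h

theorem raisesWave_map_singleton {l : List (Fin m)} (hl : l.Nodup) (hmem : ∀ x, x ∈ l)
    (h : Fin m → ℕ)
    (hp : l.Pairwise fun i k : Fin m => ((i : ℕ) + 1 = k ∨ (k : ℕ) + 1 = i) → h k = h i + 1) :
    RaisesWave (l.map fun i => ({i} : Finset (Fin m))) :=
  ⟨h, fun c ε hε hc => by
    rw [← tiltedWave_add_two]
    simpa using resampleList_singleton_tiltedWave_aux hε hc l ∅ hl (by simpa using hmem) hp
      (by simp)⟩

theorem raisesWave_finRange :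
    RaisesWave ((List.finRange m).map fun i => ({i} : Finset (Fin m))) := by
  refine raisesWave_map_singleton (List.nodup_finRange m) (List.mem_finRange) (fun i => i) ?_
  refine (List.pairwise_lt_finRange m).imp ?_
  intro i k hik hadj
  have : (i : ℕ) < k := hik
  omega

theorem raisesWave_finRange_reverse :
    RaisesWave ((List.finRange m).reverse.map fun i => ({i} : Finset (Fin m))) := by
  refine raisesWave_map_singleton (List.nodup_reverse.2 (List.nodup_finRange m))
    (fun x => List.mem_reverse.2 (List.mem_finRange x)) (fun i => m - i) ?_
  refine List.pairwise_reverse.2 ((List.pairwise_lt_finRange m).imp ?_)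
  intro i k hik hadj
  have : (i : ℕ) < k := hik
  have := k.2
  omega

/-- Heights `0` on `A` and `1` on `B`: updating `A` lifts it to `2`, one above `B`, so that `B` in
turn lies below its neighbours. -/
theorem raisesWave_pair {A B : Finset (Fin m)} (hAB : Disjoint A B)
    (hcover : A ∪ B = Finset.univ)
    (hA : ∀ i ∈ A, ∀ k ∈ A, (i : ℕ) + 1 ≠ k) (hB : ∀ i ∈ B, ∀ k ∈ B, (i : ℕ) + 1 ≠ k) :
    RaisesWave [A, B] := by
  have memB : ∀ i, i ∉ A → i ∈ B := fun i hi =>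
    (Finset.mem_union.1 (hcover ▸ Finset.mem_univ i)).resolve_left hi
  have memA : ∀ i, i ∉ B → i ∈ A := fun i hi =>
    (Finset.mem_union.1 (hcover ▸ Finset.mem_univ i)).resolve_right hi
  have disj : ∀ i ∈ A, i ∉ B := fun i hi => Finset.disjoint_left.1 hAB hi
  refine ⟨fun i => if i ∈ A then 0 else 1, fun c ε hε hc => ?_⟩
  rw [← tiltedWave_add_two, resampleList, resampleList, resampleList, LinearMap.comp_apply,
    LinearMap.comp_apply, LinearMap.id_apply, resample_tiltedWave hε hc,
    resample_tiltedWave hε hc]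
  · congr 1
    ext i
    by_cases hi : i ∈ A
    · simp [hi, disj i hi]
    · simp [hi, memB i hi]
  · intro i hi k hk
    have hiA : i ∉ A := fun h => disj i h hi
    have hkA : k ∈ A := memA k fun hkB => by
      rcases hk with h | h
      · exact hB i hi k hkB h
      · exact hB k hkB i hi h
    simp [hiA, hkA]
  · intro i hi k hk
    have hkA : k ∉ A := fun hkA => by
      rcases hk with h | h
      · exact hA i hi k hkA h
      · exact hA k hkA i hi h
    simp [hi, hkA]

theorem resampleList_apply_eq_zero {c : ℝ} (hc : ∀ v j, c * (pathAdj m).mulVec v j = 0)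
    (l : List (Finset (Fin m))) (v : Fin m → ℝ) (j : Fin m) (hj : v j = 0 ∨ ∃ I ∈ l, j ∈ I) :
    resampleList c l v j = 0 := by
  induction l generalizing v with
  | nil => exact hj.resolve_right (by simp)
  | cons I l ih =>
    refine ih (resample c I v) ?_
    rw [resample_apply]
    by_cases hI : j ∈ I
    · rw [if_pos hI, hc]; exact Or.inl rfl
    · rw [if_neg hI]
      simpa [hI] using hj

/-- For `γ > 0` the damped unsigned wave is positive. For `γ = 0` every updated coordinate becomes
zero, and any positive vector serves since all sites are covered. -/
theorem RaisesWave.exists_pos (hm : 1 ≤ m) {l : List (Finset (Fin m))} (hl : RaisesWave l)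
    (hcover : ∀ j, ∃ I ∈ l, j ∈ I) (c : ℝ) :
    ∃ w : Fin m → ℝ, (∀ j, 0 < w j) ∧ resampleList |c| l w = pathTop m c ^ 2 • w := by
  rcases (pathTop_nonneg hm c).eq_or_lt with h0 | hpos
  · refine ⟨fun _ => 1, fun _ => one_pos, ?_⟩
    ext j
    rw [resampleList_apply_eq_zero (mul_pathAdj_mulVec_eq_zero (by rw [pathTop_abs, ← h0])) l _ j
      (Or.inr (hcover j)), ← h0]
    simp
  · obtain ⟨h, hh⟩ := hl
    refine ⟨tiltedWave m (pathTop m c) 1 h, fun j => mul_pos (by positivity) (wave_one_pos j), ?_⟩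
    have := hh |c| 1 (by norm_num) (by simp)
    rwa [pathTop_abs] at this

theorem RaisesWave.exists_eigenvector (hm : 1 ≤ m) {l : List (Finset (Fin m))}
    (hl : RaisesWave l) {c : ℝ} (hpos : 0 < pathTop m c) :
    ∃ v : Fin m → ℝ, v ≠ 0 ∧ resampleList c l v = pathTop m c ^ 2 • v := by
  obtain ⟨h, hh⟩ := hl
  obtain ⟨ε, hε, hc⟩ := exists_sign c
  refine ⟨tiltedWave m (pathTop m c) ε h, fun h0 => ?_, hh c ε hε hc⟩
  have := congrFun h0 ⟨0, hm⟩
  exact mul_ne_zero (pow_ne_zero _ hpos.ne') (wave_ne_zero _ hε) this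

/-- On average over the sites, resampling contracts the weighted `ℓ¹`-norm. -/
theorem sum_sum_wave_mul_abs_resample_le (c : ℝ) (v : Fin m → ℝ) :
    ∑ i, ∑ j, wave m 1 j * |resample c {i} v j| ≤
      (m - 1 + pathTop m c) * ∑ j, wave m 1 j * |v j| := by
  have hwave := mul_pathAdj_mulVec_wave (m := m) (c := |c|) (ε := 1) (by norm_num) (by simp)
  have h1 : ∀ i, ∑ j, wave m 1 j * |resample c {i} v j| ≤
      (∑ j, wave m 1 j * |v j|) - wave m 1 i * |v i| +
        wave m 1 i * (|c| * ∑ k, pathAdj m i k * |v k|) := fun i => by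
    rw [← Finset.add_sum_erase _ _ (Finset.mem_univ i),
      ← Finset.add_sum_erase _ (fun j => wave m 1 j * |v j|) (Finset.mem_univ i)]
    have e : ∑ j ∈ Finset.univ.erase i, wave m 1 j * |resample c {i} v j| =
        ∑ j ∈ Finset.univ.erase i, wave m 1 j * |v j| :=
      Finset.sum_congr rfl fun j hj => by
        rw [resample_apply, if_neg (by simpa using Finset.ne_of_mem_erase hj)]
    have hi : |resample c {i} v i| ≤ |c| * ∑ k, pathAdj m i k * |v k| := by
      have := abs_resample_le (c := c) (I := {i}) (v := v) (u := fun k => |v k|)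
        (fun _ => le_rfl) i
      rwa [resample_apply |c|, if_pos (by simp)] at this
    have := mul_le_mul_of_nonneg_left hi (wave_one_pos i).le
    rw [e]
    linarith
  refine (Finset.sum_le_sum fun i _ => h1 i).trans (le_of_eq ?_)
  -- Symmetry of the adjacency matrix moves it onto the weights, where the eigenvalue equation
  -- applies.
  have h2 : ∑ i, wave m 1 i * (|c| * ∑ k, pathAdj m i k * |v k|) =
      pathTop m c * ∑ j, wave m 1 j * |v j| := by
    simp_rw [Finset.mul_sum]
    rw [Finset.sum_comm]
    refine Finset.sum_congr rfl fun k _ => ?_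
    rw [← mul_assoc, ← pathTop_abs, ← hwave k]
    simp only [Matrix.mulVec, dotProduct, Finset.mul_sum, Finset.sum_mul]
    refine Finset.sum_congr rfl fun i _ => ?_
    rw [pathAdj_comm i k]; ring
  rw [Finset.sum_add_distrib, Finset.sum_sub_distrib, h2]
  simp only [Finset.sum_const, Finset.card_univ, Fintype.card_fin, nsmul_eq_mul]
  ring

/-- Of the `m` single-site updates, `m - 1` keep a given coordinate and one multiplies it by the top
eigenvalue. -/
theorem sum_resample_wave {c ε : ℝ} (hε : ε * ε = 1) (hc : c * ε = |c|) :
    ∑ i, resample c {i} (wave m ε) = (m - 1 + pathTop m c) • wave m ε := by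
  ext j
  rw [Finset.sum_apply, ← Finset.add_sum_erase _ _ (Finset.mem_univ j), resample_apply,
    if_pos (by simp), mul_pathAdj_mulVec_wave hε hc,
    Finset.sum_congr rfl fun i hi => by
      rw [resample_apply, if_neg (by simpa using (Finset.ne_of_mem_erase hi).symm)],
    Finset.sum_const, Finset.card_erase_of_mem (Finset.mem_univ j), Finset.card_univ,
    Fintype.card_fin, nsmul_eq_mul, Nat.cast_sub (Nat.one_le_of_lt j.2)]
  simp
  ring

end Path

/-! ### Gaussian laws with path precision -/

section GaussianPath

variable {m : ℕ} {G : Measure (Fin m → ℝ)} [IsGaussian G]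

/-- The precision matrix of `G` is a multiple of `1 - c A`, for the adjacency matrix `A` of the
path. -/
structure HasPathPrecision (G : Measure (Fin m → ℝ)) (c : ℝ) : Prop where
  mul_cov : precMatrix G * covMatrix G = 1
  exists_eq : ∃ α : ℝ, α ≠ 0 ∧ precMatrix G = α • (1 - c • pathAdj m)

theorem memLp_eval (i : Fin m) : MemLp (fun x : Fin m → ℝ => x i) 2 G :=
  (IsGaussian.hasGaussianLaw_id (μ := G)).memLp_two.eval i

theorem covariance_sum_mul_sum_mul (a b : Fin m → ℝ) :
    covariance (fun x : Fin m → ℝ => ∑ i, a i * x i) (fun x => ∑ k, b k * x k) G =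
      ∑ i, ∑ k, a i * b k * covMatrix G i k := by
  rw [covariance_fun_sum_fun_sum (fun i => (memLp_eval i).const_mul _)
    (fun i => (memLp_eval i).const_mul _)]
  refine Finset.sum_congr rfl fun i _ => Finset.sum_congr rfl fun k _ => ?_
  rw [covariance_const_mul_left, covariance_const_mul_right]
  simp [covMatrix]; ring

omit [IsGaussian G] in
theorem covMatrix_comm (i j : Fin m) : covMatrix G i j = covMatrix G j i := by
  simp [covMatrix, covariance_comm]

/-- For `j ∈ I` the error is `α⁻¹` times row `j` of `Λ` applied to `x`, and `ΛΣ = 1` makes it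
uncorrelated with every other coordinate, in particular those outside `I`. Joint Gaussianity
upgrades this to independence. Since `I` contains no neighbours, the prediction uses outside
coordinates only. -/
theorem HasPathPrecision.isPrediction {c : ℝ} (h : HasPathPrecision G c) {I : Finset (Fin m)}
    (hI : ∀ i ∈ I, ∀ k ∈ I, (i : ℕ) + 1 ≠ k) : IsPrediction G I (resample c I) := by
  have hadj : ∀ j ∈ I, ∀ k ∈ I, pathAdj m j k = 0 := fun j hj k hk =>
    pathAdj_eq_zero (not_or.2 ⟨hI j hj k hk, hI k hk j hj⟩)
  constructor
  · intro x y hxy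
    ext j
    rw [resample_apply, resample_apply]
    split_ifs with hj
    · congr 1
      simp only [Matrix.mulVec, dotProduct]
      refine Finset.sum_congr rfl fun k _ => ?_
      by_cases hk : k ∈ I
      · simp [hadj j hj k hk]
      · simp only [hxy k hk]
    · exact hxy j hj
  · let B : (Fin m → ℝ) →L[ℝ] (Fin m → ℝ) := (resample c I).toContinuousLinearMap
    let P : (Fin m → ℝ) →L[ℝ] ((Iᶜ : Finset (Fin m)) → ℝ) :=
      ContinuousLinearMap.pi fun i => ContinuousLinearMap.proj (i : Fin m)
    have hlaw : HasGaussianLaw (fun x : Fin m → ℝ =>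
        ((fun i : (Iᶜ : Finset (Fin m)) => x i), (fun j : Fin m => x j - resample c I x j))) G :=
      (IsGaussian.hasGaussianLaw_id (μ := G)).map (P.prod (ContinuousLinearMap.id ℝ _ - B))
    refine hlaw.indepFun_of_covariance_eval fun i j => ?_
    by_cases hj : j ∈ I
    · obtain ⟨α, hα, hprec⟩ := h.exists_eq
      have hij : j ≠ i := fun hji => Finset.mem_compl.1 i.2 (hji ▸ hj)
      have e1 : (fun x : Fin m → ℝ => x i) = fun x => ∑ l : Fin m, (if l = (i : Fin m) then 1 else 0) * x l := by
        ext x; simp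
      have e2 : (fun x : Fin m → ℝ => x j - resample c I x j) =
          fun x => ∑ k, (α⁻¹ * precMatrix G j k) * x k := by
        ext x
        have : ∀ k, α⁻¹ * precMatrix G j k * x k =
            (1 : Matrix (Fin m) (Fin m) ℝ) j k * x k - c * (pathAdj m j k * x k) := fun k => by
          rw [hprec]
          simp only [Matrix.smul_apply, Matrix.sub_apply, smul_eq_mul]
          field_simp
        rw [resample_apply, if_pos hj, Finset.sum_congr rfl fun k _ => this k,
          Finset.sum_sub_distrib, ← Finset.mul_sum]
        simp [Matrix.one_apply, Matrix.mulVec, dotProduct]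
      rw [e1, e2]
      refine (covariance_sum_mul_sum_mul (fun l => if l = (i : Fin m) then 1 else 0)
        (fun k => α⁻¹ * precMatrix G j k)).trans ?_
      simp only [ite_mul, one_mul, zero_mul, Finset.sum_ite_irrel, Finset.sum_const_zero,
        Finset.sum_ite_eq', Finset.mem_univ, if_true]
      have := congrFun (congrFun h.mul_cov j) i
      rw [Matrix.mul_apply, Matrix.one_apply_ne hij] at this
      rw [← mul_zero α⁻¹, ← this, Finset.mul_sum]
      exact Finset.sum_congr rfl fun k _ => by rw [covMatrix_comm (i : Fin m) k]; ring
    · have e : (fun x : Fin m → ℝ => x j - resample c I x j) = fun _ => 0 := by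
        ext x; simp [resample_apply, hj]
      rw [e]; exact covariance_const_right _

/-- Pairing an affine function with the dual of `v` evaluates its linear part at `v`. -/
theorem exists_inner_eq_apply (hΛ : precMatrix G * covMatrix G = 1) (v : Fin m → ℝ) :
    ∃ ψ : Lp ℝ 2 G, inner ℝ (oneLp G) ψ = 0 ∧
      ∀ (ℓ : (Fin m → ℝ) →ₗ[ℝ] ℝ) (φ : Lp ℝ 2 G), IsAffineClass ℓ φ → inner ℝ φ ψ = ℓ v := by
  -- For `Y = (Λ v) · x`, the covariance of `ℓ` and `Y` is `ℓ(Σ Λ v) = ℓ v`; centring `Y` gives `ψ`.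
  set b := (precMatrix G).mulVec v with hb
  set Y : (Fin m → ℝ) → ℝ := fun x => ∑ k, b k * x k with hY
  have hYm : MemLp Y 2 G := memLp_finsetSum _ fun k _ => (memLp_eval k).const_mul _
  have hYi : Integrable Y G := hYm.integrable (by norm_num)
  have hY' : MemLp (fun x => Y x - ∫ y, Y y ∂G) 2 G := hYm.sub (memLp_const _)
  have hmean : ∫ x, (Y x - ∫ y, Y y ∂G) ∂G = 0 := by
    rw [integral_sub hYi (integrable_const _)]; simp
  refine ⟨hY'.toLp, ?_, fun ℓ φ ⟨a, hφ⟩ => ?_⟩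
  · rw [inner_oneLp, integral_congr_ae hY'.coeFn_toLp, hmean]
  · have hℓ : ∀ x, ℓ x = ∑ i, ℓ (Pi.single i 1) * x i := fun x => by
      rw [LinearMap.pi_apply_eq_sum_univ ℓ x]
      refine Finset.sum_congr rfl fun i _ => ?_
      rw [smul_eq_mul, mul_comm]
      congr 2; ext j; simp [Pi.single_apply, eq_comm]
    have hℓm : MemLp (fun x => ∑ i, ℓ (Pi.single i 1) * x i) 2 G :=
      memLp_finsetSum _ fun k _ => (memLp_eval k).const_mul _
    have h1 : inner ℝ φ hY'.toLp = ∫ x, ((∑ i, ℓ (Pi.single i 1) * x i) + a) *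
        (Y x - ∫ y, Y y ∂G) ∂G := by
      rw [L2.inner_def]
      refine integral_congr_ae ?_
      filter_upwards [hφ, hY'.coeFn_toLp] with x h1 h2
      rw [h1, h2, ← hℓ]; simp [mul_comm]
    have h2 := covariance_eq_sub (hℓm.add (memLp_const a)) hY'
    rw [hmean, mul_zero, sub_zero] at h2
    rw [h1]
    refine h2.symm.trans ?_
    have e1 := covariance_sub_const_right (μ := G) hYi (∫ y, Y y ∂G)
      (X := (fun x => ∑ i, ℓ (Pi.single i 1) * x i) + fun _ => a)
    rw [e1]
    have e2 := covariance_add_const_left (μ := G) (hℓm.integrable (by norm_num)) a (Y := Y)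
    refine e2.trans ?_
    rw [hY, covariance_sum_mul_sum_mul, hℓ v]
    refine Finset.sum_congr rfl fun i _ => ?_
    have hcomm : covMatrix G * precMatrix G = 1 := mul_eq_one_comm.1 hΛ
    have e3 : ∑ k, covMatrix G i k * b k = v i := by
      have : (covMatrix G).mulVec b = v := by
        rw [hb, Matrix.mulVec_mulVec, hcomm, Matrix.one_mulVec]
      exact congrFun this i
    rw [← e3, Finset.mul_sum]
    exact Finset.sum_congr rfl fun k _ => by ring

end GaussianPath

/-! ### Convergence rates of the three schemes -/

section Schemes

theorem BlockingScheme.represents_sweep {m : ℕ} (S : BlockingScheme m)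
    (hq : ∀ i, ∑ j, S.q i j = 1) (π : Measure (Fin m → ℝ)) [IsProbabilityMeasure π] :
    IsMarkovKernel (S.sweep π) ∧ Represents π (S.sweep π)
      ((List.finRange S.k).map fun i => ∑ j, (S.q i j).toReal • gibbsOp π (S.A j)).prod := by
  have : ∀ i, IsMarkovKernel (mixture (S.q i) fun j => gibbsUpdate π (S.A j)) :=
    fun i => isMarkovKernel_mixture (hq i)
  have h := Represents.foldl (π := π)
    (fun i => Represents.mixture (hq i) fun j => represents_gibbsUpdate π (S.A j))
    (List.finRange S.k) (represents_id (π := π))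
  simpa only [one_mul] using! h

theorem sum_delta_smul {k : ℕ} {V : Type*} [AddCommGroup V] [Module ℝ V] (i : Fin k)
    (T : Fin k → V) :
    ∑ j, ((if j = i then 1 else 0 : ℝ≥0∞)).toReal • T j = T i := by
  rw [Finset.sum_eq_single i]
  · simp
  · intro j _ hj; simp [hj]
  · simp

variable {m : ℕ} {G : Measure (Fin m → ℝ)} [IsGaussian G] {c : ℝ}

theorem memLp_id_two : MemLp id 2 G := (IsGaussian.hasGaussianLaw_id (μ := G)).memLp_two

theorem integrable_id_of_isGaussian : Integrable id G :=
  (IsGaussian.hasGaussianLaw_id (μ := G)).integrable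

/-- No two elements of the block are neighbours. -/
def IsScattered (I : Finset (Fin m)) : Prop := ∀ i ∈ I, ∀ k ∈ I, (i : ℕ) + 1 ≠ k

theorem isScattered_singleton (i : Fin m) : IsScattered {i} := by
  intro a ha b hb
  rw [Finset.mem_singleton.1 ha, Finset.mem_singleton.1 hb]
  omega

/-- The leftmost operator acts last on `φ` but its matrix acts first on the increment, so the
matrices follow the order of updating. -/
theorem HasPathPrecision.hasModulus_list (h : HasPathPrecision G c) {l : List (Finset (Fin m))}
    (hl : ∀ I ∈ l, IsScattered I) {N : (Fin m → ℝ) → ℝ} {φ : Lp ℝ 2 G} (hφ : HasModulus N φ) :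
    HasModulus (fun v => N (resampleList c l v)) ((l.map (gibbsOp G)).prod φ) := by
  induction l with
  | nil => exact hφ
  | cons I l ih =>
    exact (h.isPrediction (hl I (by simp))).hasModulus integrable_id_of_isGaussian
      (ih fun J hJ => hl J (by simp [hJ]))

theorem HasPathPrecision.isAffineClass_list (h : HasPathPrecision G c)
    {l : List (Finset (Fin m))} (hl : ∀ I ∈ l, IsScattered I) {ℓ : (Fin m → ℝ) →ₗ[ℝ] ℝ}
    {φ : Lp ℝ 2 G} (hφ : IsAffineClass ℓ φ) :
    IsAffineClass (ℓ ∘ₗ resampleList c l) ((l.map (gibbsOp G)).prod φ) := by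
  induction l with
  | nil => exact hφ
  | cons I l ih =>
    exact (h.isPrediction (hl I (by simp))).isAffineClass integrable_id_of_isGaussian
      (ih fun J hJ => hl J (by simp [hJ]))

theorem HasPathPrecision.hasModulus_list_pow (h : HasPathPrecision G c)
    {l : List (Finset (Fin m))} (hl : ∀ I ∈ l, IsScattered I) {N : (Fin m → ℝ) → ℝ}
    {φ : Lp ℝ 2 G} (hφ : HasModulus N φ) (n : ℕ) :
    HasModulus (fun v => N ((resampleList c l ^ n) v)) (((l.map (gibbsOp G)).prod ^ n) φ) := by
  induction n with
  | zero => exact hφ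
  | succ n ih =>
    rw [pow_succ' (l.map (gibbsOp G)).prod, pow_succ (resampleList c l)]
    exact h.hasModulus_list hl ih

/-- Lipschitz constants contract at the rate of the top eigenvalue. -/
theorem HasPathPrecision.exists_lipschitz_contraction (h : HasPathPrecision G c) (hm : 1 ≤ m)
    {l : List (Finset (Fin m))} (hl : ∀ I ∈ l, IsScattered I) (hcover : ∀ j, ∃ I ∈ l, j ∈ I)
    (hw : RaisesWave l) :
    ∃ C : ℝ, 0 ≤ C ∧ ∀ (n : ℕ) (L : ℝ) (φ : Lp ℝ 2 G), 0 ≤ L →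
      HasModulus (fun v => L * ‖v‖) φ →
      HasModulus (fun v => C * (pathTop m c ^ 2) ^ n * L * ‖v‖)
        (((l.map (gibbsOp G)).prod ^ n) φ) := by
  obtain ⟨w, hpos, hw⟩ := hw.exists_pos hm hcover c
  obtain ⟨C, hC, hbound⟩ := norm_resampleList_pow_le (sq_nonneg (pathTop m c)) hpos hw
  refine ⟨C, hC, fun n L φ hL hφ => (h.hasModulus_list_pow hl hφ n).mono fun v => ?_⟩
  calc L * ‖(resampleList c l ^ n) v‖ ≤ L * (C * (pathTop m c ^ 2) ^ n * ‖v‖) := by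
        gcongr; exact hbound n v
    _ = _ := by ring

/-- The rate of a sweep through scattered blocks in a fixed order. -/
theorem HasPathPrecision.isL2ConvergenceRate_list (h : HasPathPrecision G c) (hm : 1 ≤ m)
    {l : List (Finset (Fin m))} (hl : ∀ I ∈ l, IsScattered I) (hcover : ∀ j, ∃ I ∈ l, j ∈ I)
    (hw : RaisesWave l) (hw' : RaisesWave l.reverse) {K : Kernel (Fin m → ℝ) (Fin m → ℝ)}
    [IsMarkovKernel K] (hK : Represents G K (l.map (gibbsOp G)).prod) :
    IsL2ConvergenceRate G K (pathTop m c ^ 2) := by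
  have he : ∀ I, gibbsOp G I (oneLp G) = oneLp G := fun I => (represents_gibbsUpdate G I).oneLp
  obtain ⟨C, hC, hmod⟩ := h.exists_lipschitz_contraction hm hl hcover hw
  obtain ⟨C', hC', hmod'⟩ := h.exists_lipschitz_contraction hm (l := l.reverse)
    (fun I hI => hl I (List.mem_reverse.1 hI)) (fun j => by simpa using hcover j) hw'
  refine isL2ConvergenceRate_of_represents hK (sq_nonneg _) (hC.trans (le_max_left C C')) ?_
    fun hpos => ?_
  -- The factors are self-adjoint, so the adjoint of the sweep is the sweep through the reversed
  -- list.
  · refine norm_pow_apply_sub_le memLp_id_two (T' := (l.reverse.map (gibbsOp G)).prod)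
      (inner_list_prod_apply (inner_gibbsOp G) l) (list_prod_apply_eq_self he _)
      (list_prod_apply_eq_self he _) (hC.trans (le_max_left C C')) (sq_nonneg _) ?_ ?_
    · refine fun n L φ hL hφ => (hmod n L φ hL hφ).mono fun v => ?_
      gcongr; exact le_max_left _ _
    · refine fun n L φ hL hφ => (hmod' n L φ hL hφ).mono fun v => ?_
      gcongr; exact le_max_right _ _
  · have hpos' : 0 < pathTop m c :=
      (pathTop_nonneg hm c).lt_of_ne fun h0 => by rw [← h0] at hpos; norm_num at hpos
    obtain ⟨v, hv, hMv⟩ := hw.exists_eigenvector hm hpos'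
    obtain ⟨ψ, hψ0, hψ⟩ := exists_inner_eq_apply h.mul_cov v
    exact exists_le_norm_pow_apply_sub memLp_id_two (fun ℓ φ => h.isAffineClass_list hl) hv hMv
      hψ0 hψ

theorem HasPathPrecision.isL2ConvergenceRate_lexicographic (h : HasPathPrecision G c)
    (hm : 1 ≤ m) : IsL2ConvergenceRate G ((lexicographic m).sweep G) (pathTop m c ^ 2) := by
  obtain ⟨hM, hK⟩ := (lexicographic m).represents_sweep
    (fun (i : Fin m) => by
      change ∑ j : Fin m, (if j = i then (1 : ℝ≥0∞) else 0) = 1; simp) G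
  have e : ((List.finRange (lexicographic m).k).map fun i =>
      ∑ j, ((lexicographic m).q i j).toReal • gibbsOp G ((lexicographic m).A j)) =
      ((List.finRange m).map fun i => ({i} : Finset (Fin m))).map (gibbsOp G) := by
    rw [List.map_map]
    exact List.map_congr_left fun i _ => sum_delta_smul (k := m) i fun j => gibbsOp G {j}
  rw [e] at hK
  refine h.isL2ConvergenceRate_list hm ?_ ?_ raisesWave_finRange ?_ hK
  · simpa using fun i => isScattered_singleton i
  · intro j; exact ⟨{j}, by simp, by simp⟩
  · rw [← List.map_reverse]; exact raisesWave_finRange_reverse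

theorem HasPathPrecision.isL2ConvergenceRate_checkerboard (h : HasPathPrecision G c)
    (hm : 1 ≤ m) {A : Fin 2 → Finset (Fin m)} (hA : IsInterlacedPartition A) :
    IsL2ConvergenceRate G ((checkerboard A).sweep G) (pathTop m c ^ 2) := by
  obtain ⟨hdisj, hcover, hint⟩ := hA
  -- Strictly between neighbouring sites there is no site, so an interlaced block cannot contain two
  -- neighbours.
  have hsc : ∀ i, IsScattered (A i) := fun i a ha b hb hab => by
    obtain ⟨d, -, h1, h2⟩ := hint i a ha b hb (Fin.lt_def.2 (by omega))
    rw [Fin.lt_def] at h1 h2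
    omega
  obtain ⟨hM, hK⟩ := (checkerboard A).represents_sweep (fun (i : Fin 2) => by
      change ∑ j : Fin 2, (if j = i then (1 : ℝ≥0∞) else 0) = 1; simp) G
  have e : ((List.finRange (checkerboard A).k).map fun i =>
      ∑ j, ((checkerboard A).q i j).toReal • gibbsOp G ((checkerboard A).A j)) =
      [A 0, A 1].map (gibbsOp G) := by
    have : [A 0, A 1].map (gibbsOp G) = (List.finRange 2).map fun i => gibbsOp G (A i) := rfl
    rw [this]
    exact List.map_congr_left fun i _ => sum_delta_smul (k := 2) i fun j => gibbsOp G (A j)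
  rw [e] at hK
  refine h.isL2ConvergenceRate_list hm ?_ ?_
    (raisesWave_pair hdisj hcover (hsc 0) (hsc 1)) ?_ hK
  · simpa using ⟨hsc 0, hsc 1⟩
  · intro j
    have : j ∈ A 0 ∪ A 1 := hcover ▸ Finset.mem_univ j
    simpa using this
  · exact raisesWave_pair hdisj.symm (by rw [Finset.union_comm, hcover]) (hsc 1) (hsc 0)

omit [IsGaussian G] in
theorem HasModulus.sum_smul {k : ℕ} {q : ℝ} (hq : 0 ≤ q) {N : Fin k → (Fin m → ℝ) → ℝ}
    {φ : Fin k → Lp ℝ 2 G} (h : ∀ i, HasModulus (N i) (φ i)) :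
    HasModulus (fun v => ∑ i, q * N i v) (∑ i, q • φ i) := by
  choose f hK hN hφ using h
  choose K hK using hK
  have hdiff : ∀ x y (D : Fin k → ℝ), (∀ i, |f i x - f i y| ≤ D i) →
      |(∑ i, q * f i x) - ∑ i, q * f i y| ≤ ∑ i, q * D i := fun x y D hD => by
    rw [← Finset.sum_sub_distrib]
    refine (Finset.abs_sum_le_sum_abs _ _).trans (Finset.sum_le_sum fun i _ => ?_)
    rw [← mul_sub, abs_mul, abs_of_nonneg hq]
    exact mul_le_mul_of_nonneg_left (hD i) hq
  refine ⟨fun x => ∑ i, q * f i x, ⟨∑ i, q.toNNReal * K i, ?_⟩, ?_, ?_⟩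
  · refine LipschitzWith.of_dist_le_mul fun x y => ?_
    rw [Real.dist_eq]
    refine (hdiff x y (fun i => K i * dist x y) fun i => ?_).trans (le_of_eq ?_)
    · rw [← Real.dist_eq]; exact (hK i).dist_le_mul x y
    · simp only [NNReal.coe_sum, NNReal.coe_mul, Real.coe_toNNReal q hq, Finset.sum_mul, mul_assoc]
  · exact fun x y => hdiff x y _ fun i => hN i x y
  · have h1 : ∀ᵐ x ∂G, ∀ i, (q • φ i : Lp ℝ 2 G) x = q * φ i x :=
      ae_all_iff.2 fun j => Lp.coeFn_smul _ _
    filter_upwards [Lp.coeFn_finsetSum Finset.univ fun i => q • φ i, h1, ae_all_iff.2 hφ]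
      with x h2 h3 h4
    rw [h2, Finset.sum_apply]
    exact Finset.sum_congr rfl fun i _ => by rw [h3, h4]

omit [IsGaussian G] in
theorem IsAffineClass.sum_smul {k : ℕ} {q : ℝ} {ℓ : Fin k → (Fin m → ℝ) →ₗ[ℝ] ℝ}
    {φ : Fin k → Lp ℝ 2 G} (h : ∀ i, IsAffineClass (ℓ i) (φ i)) :
    IsAffineClass (∑ i, q • ℓ i) (∑ i, q • φ i) := by
  choose b hφ using h
  refine ⟨∑ i, q * b i, ?_⟩
  have h1 : ∀ᵐ x ∂G, ∀ i, (q • φ i : Lp ℝ 2 G) x = q * φ i x :=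
    ae_all_iff.2 fun j => Lp.coeFn_smul _ _
  filter_upwards [Lp.coeFn_finsetSum Finset.univ fun i => q • φ i, h1, ae_all_iff.2 hφ]
    with x h2 h3 h4
  rw [h2, Finset.sum_apply, LinearMap.sum_apply, ← Finset.sum_add_distrib]
  exact Finset.sum_congr rfl fun i _ => by rw [h3, h4, LinearMap.smul_apply, smul_eq_mul]; ring

/-- The operator of one update of a uniformly chosen site. -/
noncomputable def randomSiteOp (G : Measure (Fin m → ℝ)) [IsProbabilityMeasure G] :
    Lp ℝ 2 G →L[ℝ] Lp ℝ 2 G := ∑ i, (m : ℝ)⁻¹ • gibbsOp G {i}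

theorem randomSiteOp_apply (φ : Lp ℝ 2 G) :
    randomSiteOp G φ = ∑ i, (m : ℝ)⁻¹ • gibbsOp G {i} φ := by
  simp [randomSiteOp]

theorem inner_randomSiteOp (φ ψ : Lp ℝ 2 G) :
    inner ℝ (randomSiteOp G φ) ψ = inner ℝ φ (randomSiteOp G ψ) := by
  simp only [randomSiteOp_apply, sum_inner, inner_sum, inner_smul_left, inner_smul_right,
    inner_gibbsOp]
  simp

/-- The weighted `ℓ¹`-modulus contracts under the update of a random site. -/
theorem HasPathPrecision.hasModulus_randomSiteOp_pow (h : HasPathPrecision G c)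
    (hm : 1 ≤ m) {t : ℝ} (ht : 0 ≤ t) {φ : Lp ℝ 2 G}
    (hφ : HasModulus (fun v => t * ∑ j, wave m 1 j * |v j|) φ) (n : ℕ) :
    HasModulus (fun v => ((m - 1 + pathTop m c) / m) ^ n * t * ∑ j, wave m 1 j * |v j|)
      ((randomSiteOp G ^ n) φ) := by
  induction n generalizing t φ with
  | zero => simpa using hφ
  | succ n ih =>
    have hstep : HasModulus (fun v => ((m - 1 + pathTop m c) / m) * t *
        ∑ j, wave m 1 j * |v j|) (randomSiteOp G φ) := by
      rw [randomSiteOp_apply]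
      refine (HasModulus.sum_smul (inv_nonneg.2 m.cast_nonneg) fun i =>
        (h.isPrediction (isScattered_singleton i)).hasModulus integrable_id_of_isGaussian
          hφ).mono fun v => ?_
      rw [← Finset.mul_sum, ← Finset.mul_sum]
      have := mul_le_mul_of_nonneg_left (sum_sum_wave_mul_abs_resample_le c v)
        (mul_nonneg (inv_nonneg.2 (m.cast_nonneg : (0 : ℝ) ≤ m)) ht)
      calc _ = (m : ℝ)⁻¹ * t * ∑ i, ∑ j, wave m 1 j * |resample c {i} v j| := by ring
        _ ≤ _ := this
        _ = _ := by ring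
    have hnn : (0 : ℝ) ≤ (m - 1 + pathTop m c) / m := by
      have : (1 : ℝ) ≤ m := by exact_mod_cast hm
      have := pathTop_nonneg hm c
      apply div_nonneg <;> linarith
    have := ih (mul_nonneg hnn ht) hstep
    rw [pow_succ]
    refine HasModulus.mono this fun v => le_of_eq ?_
    ring

theorem HasPathPrecision.isL2ConvergenceRate_randomScan (h : HasPathPrecision G c)
    (hm : 1 ≤ m) :
    IsL2ConvergenceRate G ((randomScan m).sweep G) (((m - 1 + pathTop m c) / m) ^ m) := by
  have hm1 : (1 : ℝ) ≤ m := by exact_mod_cast hm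
  have hm0 : (m : ℝ≥0∞) ≠ 0 := by exact_mod_cast (by omega : m ≠ 0)
  set μ := (m - 1 + pathTop m c) / m with hμ
  have hμ0 : 0 ≤ μ := by
    have := pathTop_nonneg hm c
    apply div_nonneg <;> linarith
  obtain ⟨hM, hK⟩ := (randomScan m).represents_sweep (fun _ => by
    change ∑ _j : Fin m, (m : ℝ≥0∞)⁻¹ = 1
    simp [ENNReal.mul_inv_cancel hm0 (ENNReal.natCast_ne_top m)]) G
  have e : ((List.finRange (randomScan m).k).map fun i =>
      ∑ j, ((randomScan m).q i j).toReal • gibbsOp G ((randomScan m).A j)).prod =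
      randomSiteOp G ^ m := by
    have : (fun i : Fin m => ∑ j, ((randomScan m).q i j).toReal • gibbsOp G ((randomScan m).A j)) =
        fun _ => randomSiteOp G := by
      ext1 i
      change ∑ j : Fin m, ((m : ℝ≥0∞)⁻¹).toReal • gibbsOp G {j} = _
      simp [randomSiteOp]
    change ((List.finRange m).map fun i : Fin m =>
      ∑ j, ((randomScan m).q i j).toReal • gibbsOp G ((randomScan m).A j)).prod = _
    rw [this, List.map_const', List.prod_replicate, List.length_finRange]
  rw [e] at hK
  have he : randomSiteOp G (oneLp G) = oneLp G := by
    have : ∀ I, gibbsOp G I (oneLp G) = oneLp G := fun I => (represents_gibbsUpdate G I).oneLp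
    simp only [randomSiteOp_apply, this, Finset.sum_const, Finset.card_univ, Fintype.card_fin]
    rw [← Nat.cast_smul_eq_nsmul ℝ, smul_smul, mul_inv_cancel₀ (by positivity), one_smul]
  have h1 : 0 ≤ ∑ j, wave m 1 j := Finset.sum_nonneg fun j _ => (wave_one_pos j).le
  have h2 : 0 ≤ ∑ j, (wave m 1 j)⁻¹ :=
    Finset.sum_nonneg fun j _ => (inv_pos.2 (wave_one_pos j)).le
  -- The constant for passing from the sup norm to the wave-weighted `ℓ¹`-norm and back.
  set C := (∑ j, (wave m 1 j)⁻¹) * ∑ j, wave m 1 j with hC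
  have hC0 : 0 ≤ C := mul_nonneg h2 h1
  have hmod : ∀ (n : ℕ) (L : ℝ) (φ : Lp ℝ 2 G), 0 ≤ L → HasModulus (fun v => L * ‖v‖) φ →
      HasModulus (fun v => C * (μ ^ m) ^ n * L * ‖v‖) (((randomSiteOp G ^ m) ^ n) φ) := by
    intro n L φ hL hφ
    have hφ' : HasModulus (fun v => (L * ∑ j, (wave m 1 j)⁻¹) * ∑ j, wave m 1 j * |v j|) φ := by
      refine hφ.mono fun v => ?_
      rw [mul_assoc]
      refine mul_le_mul_of_nonneg_left ?_ hL
      refine (pi_norm_le_iff_of_nonneg ?_).2 fun j => ?_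
      · exact mul_nonneg h2 (Finset.sum_nonneg fun j _ =>
          mul_nonneg (wave_one_pos j).le (abs_nonneg _))
      · have hw := wave_one_pos j
        calc ‖v j‖ = (wave m 1 j)⁻¹ * (wave m 1 j * |v j|) := by
              rw [← mul_assoc, inv_mul_cancel₀ hw.ne', one_mul]; rfl
          _ ≤ _ := by
            refine mul_le_mul ?_ ?_ (by positivity) h2
            · exact Finset.single_le_sum (f := fun j => (wave m 1 j)⁻¹)
                (fun i _ => (inv_pos.2 (wave_one_pos i)).le) (Finset.mem_univ j)
            · exact Finset.single_le_sum (f := fun j => wave m 1 j * |v j|)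
                (fun i _ => mul_nonneg (wave_one_pos i).le (abs_nonneg _)) (Finset.mem_univ j)
    rw [← pow_mul, ← pow_mul]
    refine (h.hasModulus_randomSiteOp_pow hm (mul_nonneg hL h2) hφ' (m * n)).mono fun v => ?_
    have hle : ∑ j, wave m 1 j * |v j| ≤ (∑ j, wave m 1 j) * ‖v‖ := by
      rw [Finset.sum_mul]
      exact Finset.sum_le_sum fun j _ =>
        mul_le_mul_of_nonneg_left (norm_le_pi_norm v j) (wave_one_pos j).le
    calc _ ≤ μ ^ (m * n) * (L * ∑ j, (wave m 1 j)⁻¹) * ((∑ j, wave m 1 j) * ‖v‖) := by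
          gcongr
      _ = _ := by rw [hC]; ring
  refine isL2ConvergenceRate_of_represents hK (by positivity) hC0 ?_ fun _ => ?_
  · exact norm_pow_apply_sub_le memLp_id_two (inner_pow_apply inner_randomSiteOp m)
      (pow_apply_eq_self he m) (pow_apply_eq_self he m) hC0 (by positivity) hmod hmod
  -- The averaged resampling matrix `R` has the signed wave as eigenvector with eigenvalue `μ`,
  -- whose `m`-th power belongs to a full sweep.
  · obtain ⟨ε, hε, hc⟩ := exists_sign c
    obtain ⟨ψ, hψ0, hψ⟩ := exists_inner_eq_apply h.mul_cov (wave m ε)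
    let R : (Fin m → ℝ) →ₗ[ℝ] (Fin m → ℝ) := ∑ i, (m : ℝ)⁻¹ • resample c {i}
    have hR : R (wave m ε) = μ • wave m ε := by
      simp only [R, LinearMap.sum_apply, LinearMap.smul_apply]
      rw [← Finset.smul_sum, sum_resample_wave hε hc, smul_smul, hμ, div_eq_inv_mul]
    have hRaff : ∀ ℓ (φ : Lp ℝ 2 G), IsAffineClass ℓ φ →
        IsAffineClass (ℓ ∘ₗ R) (randomSiteOp G φ) := by
      intro ℓ φ hφ
      rw [randomSiteOp_apply]
      have := IsAffineClass.sum_smul (q := (m : ℝ)⁻¹) fun i =>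
        (h.isPrediction (isScattered_singleton i)).isAffineClass integrable_id_of_isGaussian hφ
      convert! this using 1
      refine LinearMap.ext fun v => ?_
      simp [R, LinearMap.sum_apply]
    have hpow : ∀ n : ℕ, (∀ ℓ (φ : Lp ℝ 2 G), IsAffineClass ℓ φ →
        IsAffineClass (ℓ ∘ₗ (R ^ n)) ((randomSiteOp G ^ n) φ)) ∧
          (R ^ n) (wave m ε) = μ ^ n • wave m ε := by
      intro n
      induction n with
      | zero => exact ⟨fun ℓ φ hφ => hφ, by simp⟩
      | succ n ih =>
        refine ⟨fun ℓ φ hφ => ?_, ?_⟩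
        · rw [pow_succ R, pow_succ' (randomSiteOp G)]
          exact hRaff _ _ (ih.1 ℓ φ hφ)
        · rw [pow_succ', Module.End.mul_apply, ih.2, map_smul, hR, smul_smul, pow_succ]
    exact exists_le_norm_pow_apply_sub memLp_id_two (hpow m).1
      (fun h0 => wave_ne_zero ⟨0, hm⟩ hε (congrFun h0 ⟨0, hm⟩)) (hpow m).2 hψ0 hψ

end Schemes

/-! ### The largest eigenvalue of `A` -/

section Spectrum

variable {m : ℕ}

theorem HasPathPrecision.matrixA_eq {G : Measure (Fin m → ℝ)} {c : ℝ}
    (h : HasPathPrecision G c) : matrixA G = c • pathAdj m := by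
  obtain ⟨α, hα, hprec⟩ := h.exists_eq
  have hdiag : ∀ i, precMatrix G i i = α := fun i => by
    rw [hprec]
    simp [pathAdj_eq_zero (show ¬((i : ℕ) + 1 = i ∨ (i : ℕ) + 1 = i) by omega)]
  rw [matrixA]
  simp only [hdiag]
  ext i j
  rw [Matrix.sub_apply, Matrix.diagonal_mul, hprec]
  simp only [Matrix.smul_apply, Matrix.sub_apply, smul_eq_mul]
  field_simp
  ring

/-- Perron–Frobenius by hand: for an eigenvector `x`, pairing `|x|` with the positive wave and using
symmetry gives `|l| ≤ γ`; the signed wave attains `γ`. -/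
theorem isMaxEigenvalue_smul_pathAdj (hm : 1 ≤ m) (c : ℝ) :
    IsMaxEigenvalue (c • pathAdj m) (pathTop m c) := by
  constructor
  · obtain ⟨ε, hε, hc⟩ := exists_sign c
    refine Module.End.hasEigenvalue_of_hasEigenvector (x := wave m ε)
      (Module.End.hasEigenvector_iff.2 ⟨Module.End.mem_eigenspace_iff.2 ?_,
        fun h0 => wave_ne_zero ⟨0, hm⟩ hε (congrFun h0 ⟨0, hm⟩)⟩)
    ext j
    rw [Matrix.toLin'_apply, Matrix.smul_mulVec]
    exact mul_pathAdj_mulVec_wave hε hc j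
  · rintro l hl
    obtain ⟨x, hx⟩ := Module.End.HasEigenvalue.exists_hasEigenvector hl
    have hxe := hx.apply_eq_smul
    rw [Matrix.toLin'_apply, Matrix.smul_mulVec] at hxe
    have hwave := mul_pathAdj_mulVec_wave (m := m) (c := |c|) (ε := 1) (by norm_num) (by simp)
    have hpos : 0 < ∑ j, wave m 1 j * |x j| := by
      obtain ⟨i, hi⟩ := Function.ne_iff.1 hx.2
      exact Finset.sum_pos' (fun j _ => mul_nonneg (wave_one_pos j).le (abs_nonneg _))
        ⟨i, Finset.mem_univ i, mul_pos (wave_one_pos i) (abs_pos.2 hi)⟩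
    refine le_of_mul_le_mul_right ?_ hpos
    calc l * ∑ j, wave m 1 j * |x j| ≤ |l| * ∑ j, wave m 1 j * |x j| := by
          gcongr; exact le_abs_self l
      _ = ∑ j, wave m 1 j * |l * x j| := by
          rw [Finset.mul_sum]; exact Finset.sum_congr rfl fun j _ => by rw [abs_mul]; ring
      _ ≤ ∑ j, wave m 1 j * (|c| * ∑ k, pathAdj m j k * |x k|) := by
          refine Finset.sum_le_sum fun j _ =>
            mul_le_mul_of_nonneg_left ?_ (wave_one_pos j).le
          have e : l * x j = c * (pathAdj m).mulVec x j := (congrFun hxe j).symm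
          rw [e, abs_mul]
          refine mul_le_mul_of_nonneg_left ?_ (abs_nonneg c)
          simp only [Matrix.mulVec, dotProduct]
          refine (Finset.abs_sum_le_sum_abs _ _).trans (le_of_eq ?_)
          exact Finset.sum_congr rfl fun k _ => by
            rw [abs_mul, abs_of_nonneg (pathAdj_nonneg j k)]
      _ = pathTop m c * ∑ j, wave m 1 j * |x j| := by
          simp_rw [Finset.mul_sum]
          rw [Finset.sum_comm]
          refine Finset.sum_congr rfl fun k _ => ?_
          rw [← mul_assoc, ← pathTop_abs, ← hwave k]
          simp only [Matrix.mulVec, dotProduct, Finset.mul_sum, Finset.sum_mul]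
          exact Finset.sum_congr rfl fun i _ => by rw [pathAdj_comm i k]; ring

end Spectrum

/-! ### Densities of nondegenerate Gaussian laws -/

section Density

variable {m : ℕ}

theorem pi_gaussianReal_eq_withDensity (ν : Fin m → ℝ) :
    Measure.pi (fun i => gaussianReal (ν i) 1) = volume.withDensity fun x =>
      ENNReal.ofReal ((√(2 * Real.pi))⁻¹ ^ m * Real.exp (-(1 / 2) * ((x - ν) ⬝ᵥ (x - ν)))) := by
  have hdens : ∀ x : Fin m → ℝ, (√(2 * Real.pi))⁻¹ ^ m *
      Real.exp (-(1 / 2) * ((x - ν) ⬝ᵥ (x - ν))) = ∏ i, gaussianPDFReal (ν i) 1 (x i) := by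
    intro x
    simp only [gaussianPDFReal, Finset.prod_mul_distrib, Finset.prod_const, Finset.card_univ,
      Fintype.card_fin, ← Real.exp_sum, NNReal.coe_one, mul_one]
    congr 2
    simp only [dotProduct, Finset.mul_sum, Pi.sub_apply]
    exact Finset.sum_congr rfl fun i _ => by ring
  simp_rw [hdens]
  refine Measure.pi_eq fun s hs => ?_
  rw [withDensity_apply _ (MeasurableSet.univ_pi hs), volume_pi, Measure.restrict_pi_pi,
    ← ofReal_integral_eq_lintegral_ofReal]
  · rw [integral_fintype_prod_eq_prod, ENNReal.ofReal_prod_of_nonneg]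
    · exact Finset.prod_congr rfl fun i _ =>
        (gaussianReal_apply_eq_integral _ one_ne_zero _).symm
    · exact fun i _ => integral_nonneg fun x => gaussianPDFReal_nonneg _ _ _
  · exact Integrable.fintype_prod fun i => (integrable_gaussianPDFReal _ _).restrict
  · exact Filter.Eventually.of_forall fun x =>
      Finset.prod_nonneg fun i _ => gaussianPDFReal_nonneg _ _ _

theorem map_withDensity_measurableEquiv {α β : Type*} [MeasurableSpace α] [MeasurableSpace β]
    (μ : Measure α) (e : α ≃ᵐ β) {f : α → ℝ≥0∞} (hf : Measurable f) :
    (μ.withDensity f).map e = (μ.map e).withDensity (f ∘ e.symm) := by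
  ext s hs
  rw [Measure.map_apply e.measurable hs, withDensity_apply _ (e.measurable hs),
    withDensity_apply _ hs, setLIntegral_map hs (hf.comp e.symm.measurable) e.measurable]
  simp

variable {G : Measure (Fin m → ℝ)} [IsGaussian G]

theorem covariance_mulVec (W : Matrix (Fin m) (Fin m) ℝ) (i j : Fin m) :
    covariance (fun x => W.mulVec x i) (fun x => W.mulVec x j) G =
      (W * covMatrix G * W.transpose) i j := by
  have := covariance_sum_mul_sum_mul (G := G) (W i) (W j)
  refine this.trans ?_
  simp only [Matrix.mul_apply, Matrix.transpose_apply, Finset.sum_mul]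
  rw [Finset.sum_comm]
  exact Finset.sum_congr rfl fun k _ => Finset.sum_congr rfl fun l _ => by ring

/-- The mean of `G`. -/
noncomputable def meanVec (G : Measure (Fin m → ℝ)) : Fin m → ℝ := fun i => ∫ x, x i ∂G

/-- The whitened coordinates are jointly Gaussian and uncorrelated with unit variances, hence
independent standard normals up to their means. -/
theorem map_whitening {W : Matrix (Fin m) (Fin m) ℝ}
    (hW : W * covMatrix G * W.transpose = 1) :
    G.map (fun x => W.mulVec x) =
      Measure.pi fun i => gaussianReal (W.mulVec (meanVec G) i) 1 := by
  have hlaw : HasGaussianLaw (fun x : Fin m → ℝ => fun i => W.mulVec x i) G :=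
    (IsGaussian.hasGaussianLaw_id (μ := G)).map (Matrix.toLin' W).toContinuousLinearMap
  have hind : iIndepFun (fun (i : Fin m) (x : Fin m → ℝ) => W.mulVec x i) G :=
    hlaw.iIndepFun_of_covariance_eq_zero fun i j hij => by
      rw [covariance_mulVec, hW, Matrix.one_apply_ne hij]
  have hmeas : ∀ i, AEMeasurable (fun x : Fin m → ℝ => W.mulVec x i) G :=
    fun i => (hlaw.eval i).aemeasurable
  have h := (iIndepFun_iff_map_fun_eq_pi_map hmeas).1 hind
  change G.map (fun x i => W.mulVec x i) = _
  rw [h]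
  congr 1
  ext1 i
  rw [(hlaw.eval i).map_eq_gaussianReal, ← covariance_self (hmeas i), covariance_mulVec, hW,
    Matrix.one_apply_eq, Real.toNNReal_one]
  congr 1
  simp only [Matrix.mulVec, dotProduct, meanVec]
  rw [integral_finsetSum _ fun k _ => ((memLp_eval k).integrable (by norm_num)).const_mul _]
  simp only [integral_const_mul]

/-- The density of a nondegenerate Gaussian law. -/
theorem exists_eq_withDensity (hS : (covMatrix G).PosDef) : ∃ K : ℝ, 0 < K ∧
    G = volume.withDensity fun z => ENNReal.ofReal (K * Real.exp (-(1 / 2) *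
      ((z - meanVec G) ⬝ᵥ (precMatrix G).mulVec (z - meanVec G)))) := by
  open scoped MatrixOrder in
  -- With `Σ = Bᵀ B` the matrix `W = (Bᵀ)⁻¹` whitens `G`; the density is pulled back from the
  -- standard one, with a determinant as Jacobian.
  obtain ⟨B, hB⟩ := CStarAlgebra.nonneg_iff_eq_star_mul_self.mp hS.posSemidef.nonneg
  rw [Matrix.star_eq_conjTranspose, Matrix.conjTranspose_eq_transpose_of_trivial] at hB
  have hdetS : (covMatrix G).det ≠ 0 := hS.det_pos.ne'
  have hdetB : B.det ≠ 0 := fun h => hdetS (by rw [hB, Matrix.det_mul, h, mul_zero])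
  have hBu : IsUnit B.det := isUnit_iff_ne_zero.2 hdetB
  set W := (B.transpose)⁻¹ with hWdef
  have hBTu : IsUnit B.transpose.det := by rwa [Matrix.det_transpose]
  have hWB : W * B.transpose = 1 := Matrix.nonsing_inv_mul _ hBTu
  have hWT : W.transpose = B⁻¹ := by
    rw [hWdef, Matrix.transpose_nonsing_inv, Matrix.transpose_transpose]
  have hW : W * covMatrix G * W.transpose = 1 := by
    rw [hB, ← Matrix.mul_assoc, hWB, Matrix.one_mul, hWT, Matrix.mul_nonsing_inv _ hBu]
  have hdetW : W.det ≠ 0 := fun h => by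
    have := congrArg Matrix.det hWB
    rw [Matrix.det_mul, h, zero_mul, Matrix.det_one] at this
    exact zero_ne_one this
  have hL : precMatrix G = W.transpose * W := by
    rw [precMatrix, hB, Matrix.mul_inv_rev, hWT]
  have hBW : B.transpose * W = 1 := mul_eq_one_comm.1 hWB
  let e : (Fin m → ℝ) ≃ᵐ (Fin m → ℝ) :=
    { toFun := B.transpose.mulVec
      invFun := W.mulVec
      left_inv := fun x => by rw [Matrix.mulVec_mulVec, hWB, Matrix.one_mulVec]
      right_inv := fun x => by rw [Matrix.mulVec_mulVec, hBW, Matrix.one_mulVec]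
      measurable_toFun := (Continuous.matrix_mulVec continuous_const continuous_id).measurable
      measurable_invFun := (Continuous.matrix_mulVec continuous_const continuous_id).measurable }
  have hG : G = (G.map W.mulVec).map e := by
    change G = (G.map e.symm).map e
    rw [Measure.map_map e.measurable e.symm.measurable, MeasurableEquiv.self_comp_symm,
      Measure.map_id]
  have hvol : (volume : Measure (Fin m → ℝ)).map e =
      ENNReal.ofReal |B.transpose.det⁻¹| • volume :=
    Real.map_matrix_volume_pi_eq_smul_volume_pi (by rwa [Matrix.det_transpose])
  refine ⟨|B.transpose.det⁻¹| * (√(2 * Real.pi))⁻¹ ^ m, ?_, ?_⟩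
  · have : B.transpose.det ≠ 0 := by rwa [Matrix.det_transpose]
    have h2 : 0 < √(2 * Real.pi) := Real.sqrt_pos.2 (by positivity)
    positivity
  · have hmeas : Measurable fun x : Fin m → ℝ => ENNReal.ofReal ((√(2 * Real.pi))⁻¹ ^ m *
        Real.exp (-(1 / 2) * ((x - W.mulVec (meanVec G)) ⬝ᵥ (x - W.mulVec (meanVec G))))) := by
      refine (ENNReal.measurable_ofReal.comp (Continuous.measurable ?_))
      simp only [dotProduct]
      fun_prop
    conv_lhs => rw [hG, show G.map W.mulVec = _ from map_whitening hW,
      pi_gaussianReal_eq_withDensity, map_withDensity_measurableEquiv _ e hmeas, hvol,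
      withDensity_smul_measure, ← withDensity_smul _ (hmeas.comp e.symm.measurable)]
    congr 1
    ext z
    simp only [Pi.smul_apply, smul_eq_mul, Function.comp_apply]
    rw [← ENNReal.ofReal_mul (abs_nonneg _), ← mul_assoc]
    congr 4
    change (W.mulVec z - W.mulVec (meanVec G)) ⬝ᵥ (W.mulVec z - W.mulVec (meanVec G)) = _
    rw [← Matrix.mulVec_sub, hL, ← Matrix.mulVec_mulVec, Matrix.dotProduct_mulVec _ W.transpose,
      Matrix.vecMul_transpose]

/-- A direction of zero variance would concentrate `G` on a hyperplane, which is Lebesgue null. -/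
theorem posDef_covMatrix (hG : G ≪ volume) : (covMatrix G).PosDef := by
  have hvar : ∀ x : Fin m → ℝ, x ⬝ᵥ (covMatrix G).mulVec x =
      variance (fun y => ∑ i, x i * y i) G := fun x => by
    rw [← covariance_self (Finset.measurable_sum _ fun i _ =>
      (measurable_pi_apply i).const_mul _).aemeasurable, covariance_sum_mul_sum_mul]
    simp only [dotProduct, Matrix.mulVec, Finset.mul_sum]
    exact Finset.sum_congr rfl fun k _ => Finset.sum_congr rfl fun l _ => by ring
  refine Matrix.PosDef.of_dotProduct_mulVec_pos ?_ fun {x} hx => ?_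
  · ext i j; simp [covMatrix, covariance_comm]
  · rw [star_trivial, hvar]
    refine (variance_nonneg _ _).lt_of_ne fun h0 => ?_
    have hm : MemLp (fun y : Fin m → ℝ => ∑ i, x i * y i) 2 G :=
      memLp_finsetSum _ fun k _ => (memLp_eval k).const_mul _
    have hev : evariance (fun y : Fin m → ℝ => ∑ i, x i * y i) G = 0 := by
      rw [← hm.ofReal_variance_eq, ← h0, ENNReal.ofReal_zero]
    have hae := (evariance_eq_zero_iff hm.aestronglyMeasurable.aemeasurable).1 hev
    set b := ∫ y, (∑ i, x i * y i) ∂G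
    let A : AffineSubspace ℝ (Fin m → ℝ) :=
      (AffineSubspace.mk' b ⊥ : AffineSubspace ℝ ℝ).comap
        ((∑ i, x i • LinearMap.proj i : (Fin m → ℝ) →ₗ[ℝ] ℝ).toAffineMap)
    have hA : ∀ y, y ∈ A ↔ ∑ i, x i * y i = b := fun y => by
      simp [A, AffineSubspace.mem_comap, AffineSubspace.mem_mk', sub_eq_zero]
    have hAne : A ≠ ⊤ := fun htop => by
      have h1 : ∀ y : Fin m → ℝ, ∑ i, x i * y i = b := fun y =>
        (hA y).1 (htop ▸ AffineSubspace.mem_top _ _ _)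
      have h2 := h1 0
      have h3 := h1 x
      simp only [Pi.zero_apply, mul_zero, Finset.sum_const_zero] at h2
      rw [← h2, Finset.sum_eq_zero_iff_of_nonneg fun i _ => mul_self_nonneg _] at h3
      exact hx (funext fun i => mul_self_eq_zero.1 (h3 i (Finset.mem_univ i)))
    have hnull : G A = 0 := hG (Measure.addHaar_affineSubspace volume A hAne)
    have hcompl : G (A : Set (Fin m → ℝ))ᶜ = 0 := by
      refine mem_ae_iff.1 ?_
      filter_upwards [hae] with y hy using (hA y).2 hy
    have := measure_univ_le_add_compl (μ := G) (A : Set (Fin m → ℝ))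
    rw [hnull, hcompl] at this
    simp at this

omit [IsGaussian G] in
/-- Probability measures with proportional densities agree. -/
theorem withDensity_eq_of_proportional {a b : ℝ} (ha : 0 ≤ a) (hb : 0 ≤ b)
    {g : (Fin m → ℝ) → ℝ} (hg : Measurable g)
    (h1 : (volume.withDensity fun z => ENNReal.ofReal (a * g z)) Set.univ = 1)
    (h2 : (volume.withDensity fun z => ENNReal.ofReal (b * g z)) Set.univ = 1) :
    (volume.withDensity fun z => ENNReal.ofReal (a * g z)) =
      volume.withDensity fun z => ENNReal.ofReal (b * g z) := by
  have hform : ∀ t : ℝ, 0 ≤ t → (volume.withDensity fun z => ENNReal.ofReal (t * g z)) =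
      ENNReal.ofReal t • volume.withDensity fun z => ENNReal.ofReal (g z) := fun t ht => by
    rw [← withDensity_smul _ hg.ennreal_ofReal]
    congr 1
    ext z
    rw [ENNReal.ofReal_mul ht]; rfl
  rw [hform a ha] at h1 ⊢
  rw [hform b hb] at h2 ⊢
  rw [Measure.smul_apply, smul_eq_mul] at h1 h2
  rw [ENNReal.eq_inv_of_mul_eq_one_left h1, ENNReal.eq_inv_of_mul_eq_one_left h2]

omit [IsGaussian G] in
/-- The covariance matrix of a law with log-quadratic density. -/
theorem covMatrix_eq_inv_of_density {Q : Matrix (Fin m) (Fin m) ℝ} (hQ : Q.PosDef)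
    (b : Fin m → ℝ) {K : ℝ} (hK : 0 ≤ K) (hG : G = volume.withDensity fun z =>
      ENNReal.ofReal (K * Real.exp (-(1 / 2) * (z ⬝ᵥ Q.mulVec z) + b ⬝ᵥ z)))
    (hprob : G Set.univ = 1) : covMatrix G = Q⁻¹ := by
  have hQu : IsUnit Q.det := isUnit_iff_ne_zero.2 hQ.det_pos.ne'
  set μ := (Q⁻¹).mulVec b with hμ
  have hQμ : Q.mulVec μ = b := by
    rw [hμ, Matrix.mulVec_mulVec, Matrix.mul_nonsing_inv _ hQu, Matrix.one_mulVec]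
  let E : EuclideanSpace ℝ (Fin m) →L[ℝ] (Fin m → ℝ) :=
    (PiLp.continuousLinearEquiv 2 ℝ fun _ => ℝ).toContinuousLinearMap
  -- The reference Gaussian: completing the square shows that `G` and it have proportional
  -- densities, so as probability measures they coincide.
  set N := multivariateGaussian (WithLp.toLp 2 μ) Q⁻¹ with hN
  set G0 := N.map E with hG0
  have hEm : AEMeasurable E N := E.continuous.measurable.aemeasurable
  have hgauss : IsGaussian G0 := by rw [hG0]; infer_instance
  have hcov : covMatrix G0 = Q⁻¹ := by
    ext i j
    simp only [covMatrix, Matrix.of_apply, hG0]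
    rw [covariance_map (measurable_pi_apply i).aestronglyMeasurable
      (measurable_pi_apply j).aestronglyMeasurable hEm]
    exact covariance_eval_multivariateGaussian hQ.posSemidef.inv i j
  have hmean : meanVec G0 = μ := by
    ext i
    rw [meanVec, hG0, integral_map hEm (measurable_pi_apply i).aestronglyMeasurable]
    have := ((ContinuousLinearMap.proj (R := ℝ) (φ := fun _ : Fin m => ℝ) i).comp
      E).integral_comp_id_comm (μ := N) IsGaussian.integrable_id
    refine this.trans ?_
    rw [integral_id_multivariateGaussian]
    rfl
  have hprec : precMatrix G0 = Q := by
    rw [precMatrix, hcov, Matrix.nonsing_inv_nonsing_inv _ hQu]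
  obtain ⟨K', hK', hdens⟩ := exists_eq_withDensity (G := G0) (by rw [hcov]; exact hQ.inv)
  rw [hprec, hmean] at hdens
  have hQs : Q.transpose = Q := by
    rw [← Matrix.conjTranspose_eq_transpose_of_trivial]; exact hQ.isHermitian
  have hsq : ∀ z : Fin m → ℝ, -(1 / 2) * (z ⬝ᵥ Q.mulVec z) + b ⬝ᵥ z =
      -(1 / 2) * ((z - μ) ⬝ᵥ Q.mulVec (z - μ)) + 1 / 2 * (b ⬝ᵥ μ) := fun z => by
    have h1 : μ ⬝ᵥ Q.mulVec z = b ⬝ᵥ z := by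
      rw [Matrix.dotProduct_mulVec, ← Matrix.mulVec_transpose, hQs, hQμ]
    simp only [Matrix.mulVec_sub, dotProduct_sub, sub_dotProduct, hQμ, h1]
    rw [dotProduct_comm z b, dotProduct_comm μ b]
    ring
  have hG' : G = volume.withDensity fun z => ENNReal.ofReal (K * Real.exp (1 / 2 * (b ⬝ᵥ μ)) *
      Real.exp (-(1 / 2) * ((z - μ) ⬝ᵥ Q.mulVec (z - μ)))) := by
    rw [hG]
    congr 1
    ext z
    rw [hsq, Real.exp_add]
    congr 1
    ring
  have hGG : G = G0 := by
    rw [hG', hdens]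
    refine withDensity_eq_of_proportional (by positivity) hK'.le ?_ ?_ ?_
    · refine Continuous.measurable ?_
      simp only [dotProduct, Matrix.mulVec]
      fun_prop
    · rw [← hG', hprob]
    · rw [← hdens]; exact measure_univ
  rw [hGG, hcov]

end Density

/-! ### Quadratic polynomials as sums along a chain -/

section Chain

/-- The sum of `q` over the consecutive pairs of `w`. -/
def chainSum (q : ℝ → ℝ → ℝ) {k : ℕ} (w : Fin (k + 1) → ℝ) : ℝ :=
  ∑ i : Fin k, q (w i.castSucc) (w i.succ)

theorem chainSum_cons (q : ℝ → ℝ → ℝ) {k : ℕ} (x : ℝ) (r : Fin (k + 1) → ℝ) :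
    chainSum q (Fin.cons x r : Fin (k + 2) → ℝ) = q x (r 0) + chainSum q r := by
  simp only [chainSum, Fin.sum_univ_succ (n := k), Fin.castSucc_zero, Fin.cons_zero,
    Fin.cons_succ, ← Fin.succ_castSucc]

theorem snoc_cons (y a : ℝ) {k : ℕ} (t : Fin k → ℝ) :
    (Fin.snoc (Fin.cons a t : Fin (k + 1) → ℝ) y : Fin (k + 2) → ℝ) =
      (Fin.cons a (Fin.snoc t y : Fin (k + 1) → ℝ) : Fin (k + 2) → ℝ) :=
  (Fin.cons_snoc_eq_snoc_cons a t y).symm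

variable {m : ℕ}

theorem withEnds_castSucc (x y : ℝ) (z : Fin m → ℝ) (i : Fin (m + 1)) :
    withEnds x y z i.castSucc = (Fin.cons x z : Fin (m + 1) → ℝ) i := by
  rw [withEnds, ← snoc_cons, Fin.snoc_castSucc]

theorem withEnds_succ (x y : ℝ) (z : Fin m → ℝ) (i : Fin (m + 1)) :
    withEnds x y z i.succ = (Fin.snoc z y : Fin (m + 1) → ℝ) i := by
  rw [withEnds, Fin.cons_succ]

theorem withEnds_zero (x y : ℝ) (z : Fin m → ℝ) : withEnds x y z 0 = x := rfl

theorem withEnds_last (x y : ℝ) (z : Fin m → ℝ) : withEnds x y z (Fin.last _) = y := by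
  rw [← Fin.succ_last, withEnds_succ, Fin.snoc_last]

theorem withEnds_castSucc_succ (x y : ℝ) (z : Fin m → ℝ) (i : Fin m) :
    withEnds x y z i.castSucc.succ = z i := by
  rw [withEnds_succ, Fin.snoc_castSucc]

theorem withEnds_add (x y : ℝ) (z u : Fin m → ℝ) (k : Fin (m + 2)) :
    withEnds x y (z + u) k = withEnds x y z k + withEnds 0 0 u k := by
  refine Fin.cases (by simp [withEnds_zero]) (fun k => ?_) k
  refine Fin.lastCases ?_ (fun k => ?_) k
  · rw [Fin.succ_last, withEnds_last, withEnds_last, withEnds_last, add_zero]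
  · simp only [withEnds_castSucc_succ, Pi.add_apply]

/-- Every interior point is once a left and once a right end of a link, so only `F + H` matters
there. -/
theorem chainSum_add_add (F H : ℝ → ℝ) (β x y : ℝ) (z : Fin m → ℝ) :
    chainSum (fun a b => -β * (a * b) + F a + H b) (withEnds x y z) =
      F x + H y + ∑ i, (F (z i) + H (z i)) - β * chainSum (fun a b => a * b) (withEnds x y z) := by
  simp only [chainSum, Finset.sum_add_distrib, ← Finset.mul_sum]
  have h1 : ∑ i : Fin (m + 1), F (withEnds x y z i.castSucc) = F x + ∑ i, F (z i) := by
    simp only [withEnds_castSucc]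
    rw [Fin.sum_univ_succ]; simp
  have h2 : ∑ i : Fin (m + 1), H (withEnds x y z i.succ) = (∑ i, H (z i)) + H y := by
    simp only [withEnds_succ]
    rw [Fin.sum_univ_castSucc]; simp
  rw [h1, h2]; ring

theorem dotProduct_pathAdj_mulVec (u v : Fin m → ℝ) : u ⬝ᵥ (pathAdj m).mulVec v =
    ∑ i : Fin (m + 1), (withEnds 0 0 u i.castSucc * withEnds 0 0 v i.succ +
      withEnds 0 0 v i.castSucc * withEnds 0 0 u i.succ) := by
  let g : ℕ → ℝ := fun k => if h : k < m + 2 then withEnds 0 0 v ⟨k, h⟩ else 0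
  have hg0 : g 0 = 0 := by simp [g, withEnds_zero]
  have hgm : g (m + 1) = 0 := by
    simp only [g, show m + 1 < m + 2 by omega, dif_pos]
    exact withEnds_last 0 0 v
  have hg : ∀ k : Fin (m + 2), withEnds 0 0 v k = g k := fun k => by simp [g]
  have hv : v = fun i : Fin m => g (i + 1) := by
    ext i
    rw [← withEnds_castSucc_succ 0 0 v i, hg]; simp
  have hadj := pathAdj_mulVec_apply g hg0 hgm
  rw [← hv] at hadj
  rw [Finset.sum_add_distrib, Fin.sum_univ_succ, Fin.sum_univ_castSucc (n := m)]
  simp only [Fin.castSucc_zero, withEnds_zero, zero_mul, zero_add, Fin.succ_last, withEnds_last,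
    mul_zero, add_zero, withEnds_castSucc_succ, ← Fin.succ_castSucc]
  rw [← Finset.sum_add_distrib, dotProduct]
  refine Finset.sum_congr rfl fun i _ => ?_
  rw [hadj, hg, hg]
  simp only [Fin.val_succ, Fin.val_castSucc]
  ring_nf

/-- The second difference removes the affine contributions of the fixed ends and leaves the
adjacency form. -/
theorem chainSum_mul_withEnds_add (x y : ℝ) (u v : Fin m → ℝ) :
    chainSum (fun a b => a * b) (withEnds x y (u + v)) + chainSum (fun a b => a * b) (withEnds x y (0 : Fin m → ℝ)) =
      chainSum (fun a b => a * b) (withEnds x y u) + chainSum (fun a b => a * b) (withEnds x y v) +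
        u ⬝ᵥ (pathAdj m).mulVec v := by
  have hu := withEnds_add x y 0 u
  have hv := withEnds_add x y 0 v
  rw [zero_add] at hu hv
  simp only [dotProduct_pathAdj_mulVec, chainSum, ← Finset.sum_add_distrib]
  refine Finset.sum_congr rfl fun i _ => ?_
  simp only [withEnds_add x y u v, hu, hv]
  ring

end Chain

section QuadraticChain

variable {n : ℕ}

/-- If the sum of `q` along the chain is a quadratic polynomial in the interior points, then `q`
is a quadratic polynomial up to terms that cancel in the interior. -/
theorem exists_quadratic_of_chainSum {q : ℝ → ℝ → ℝ} {x y κ : ℝ} {b : Fin (n + 2) → ℝ}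
    {Λ : Matrix (Fin (n + 2)) (Fin (n + 2)) ℝ} (hΛ : Λ.IsSymm)
    (h : ∀ z, chainSum q (withEnds x y z) = κ + b ⬝ᵥ z - 1 / 2 * (z ⬝ᵥ Λ.mulVec z)) :
    ∃ (F H : ℝ → ℝ) (l k : ℝ), (∀ s t, q s t = -(Λ 0 1) * (s * t) + F s + H t) ∧
      (∀ s, F s + H s = -(1 / 2) * Λ 0 0 * s ^ 2 + l * s + k) ∧
      Λ = Λ 0 0 • (1 : Matrix (Fin (n + 2)) (Fin (n + 2)) ℝ) + Λ 0 1 • pathAdj (n + 2) := by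
  have h10 : Λ 1 0 = Λ 0 1 := hΛ.apply 0 1
  -- Only the two leading knots `s`, `t` vary; `r` is the frozen remainder of the chain.
  let r : Fin (n + 1) → ℝ := Fin.snoc (0 : Fin n → ℝ) y
  let Z : ℝ → ℝ → Fin (n + 2) → ℝ := fun s t => Fin.cons s (Fin.cons t 0 : Fin (n + 1) → ℝ)
  have hZ : ∀ s t (f : ℝ → ℝ → ℝ), chainSum f (withEnds x y (Z s t)) =
      f x s + f s t + f t (r 0) + chainSum f r := fun s t f => by
    simp only [withEnds, Z, snoc_cons, chainSum_cons, Fin.cons_zero]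
    ring
  have hquad : ∀ s t, q x s + q s t + q t (r 0) + chainSum q r = κ + (b 0 * s + b 1 * t) -
      1 / 2 * (Λ 0 0 * s ^ 2 + 2 * Λ 0 1 * (s * t) + Λ 1 1 * t ^ 2) := fun s t => by
    rw [← hZ, h]
    simp [dotProduct, Matrix.mulVec, Fin.sum_univ_succ, Z, h10]
    ring
  let F : ℝ → ℝ := fun s => q s 0
  let H : ℝ → ℝ := fun t => q 0 t - q 0 0
  -- The mixed second difference in `s`, `t` isolates `q s t`; no differentiability is needed.
  have hq : ∀ s t, q s t = -(Λ 0 1) * (s * t) + F s + H t := fun s t => by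
    simp only [F, H]
    linarith [hquad s t, hquad s 0, hquad 0 t, hquad 0 0]
  have hq' : q = fun s t => -(Λ 0 1) * (s * t) + F s + H t := by ext s t; exact hq s t
  have hS : ∀ z, F x + H y + ∑ i, (F (z i) + H (z i)) - Λ 0 1 *
      chainSum (fun a b => a * b) (withEnds x y z) = κ + b ⬝ᵥ z - 1 / 2 * (z ⬝ᵥ Λ.mulVec z) :=
    fun z => by rw [← chainSum_add_add, ← hq', h]
  -- At `t = 0` the knot `s` enters through `q x s + q s 0`, that is through `F s + H s` and the
  -- term `-(Λ 0 1) x s`, which accounts for the slope.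
  obtain ⟨l, k, hg⟩ : ∃ l k, ∀ s, F s + H s = -(1 / 2) * Λ 0 0 * s ^ 2 + l * s + k := by
    refine ⟨b 0 + Λ 0 1 * x, F 0 + H 0, fun s => ?_⟩
    linear_combination hquad s 0 - hquad 0 0 - hq x s + hq x 0 - hq s 0 + hq 0 0
  refine ⟨F, H, l, k, hq, hg, ?_⟩
  -- Equality of the second differences of both quadratic expressions determines the whole matrix.
  have hbil : ∀ u v : Fin (n + 2) → ℝ, u ⬝ᵥ Λ.mulVec v =
      u ⬝ᵥ (Λ 0 0 • (1 : Matrix (Fin (n + 2)) (Fin (n + 2)) ℝ) +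
        Λ 0 1 • pathAdj (n + 2)).mulVec v := fun u v => by
    have hvu : v ⬝ᵥ Λ.mulVec u = u ⬝ᵥ Λ.mulVec v := by
      rw [Matrix.dotProduct_mulVec, ← Matrix.mulVec_transpose, hΛ, dotProduct_comm]
    have e1 := hS (u + v)
    have e2 := hS u
    have e3 := hS v
    have e4 := hS 0
    have hc := chainSum_mul_withEnds_add x y u v
    have hgg : ∑ i, (F ((u + v) i) + H ((u + v) i)) + ∑ i, (F ((0 : Fin (n + 2) → ℝ) i) +
        H ((0 : Fin (n + 2) → ℝ) i)) = ∑ i, (F (u i) + H (u i)) + ∑ i, (F (v i) + H (v i)) -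
          Λ 0 0 * (u ⬝ᵥ v) := by
      simp only [dotProduct, Finset.mul_sum, ← Finset.sum_add_distrib, ← Finset.sum_sub_distrib]
      refine Finset.sum_congr rfl fun i _ => ?_
      simp only [hg, Pi.add_apply, Pi.zero_apply]
      ring
    simp only [Matrix.mulVec_add, dotProduct_add, add_dotProduct, hvu] at e1
    simp only [Matrix.mulVec_zero, dotProduct_zero] at e4
    simp only [Matrix.add_mulVec, Matrix.smul_mulVec, Matrix.one_mulVec, dotProduct_add,
      dotProduct_smul, smul_eq_mul]
    linear_combination e1 + e4 - e2 - e3 - hgg + Λ 0 1 * hc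
  ext i j
  have := hbil (Pi.single i 1) (Pi.single j 1)
  simpa using this

end QuadraticChain

/-! ### Positivity, normalisation and correlation of the two-knot bridge -/

section Bridge

variable {m : ℕ}

theorem equidistant_succ_sub (δ : ℝ) (i : Fin (m + 1)) :
    equidistant m δ i.succ - equidistant m δ i.castSucc = δ := by
  simp [equidistant]; ring

theorem equidistant_last_sub_zero (δ : ℝ) :
    equidistant m δ (Fin.last (m + 1)) - equidistant m δ 0 = (m + 1) * δ := by
  simp [equidistant]

theorem continuous_withEnds (x y : ℝ) (k : Fin (m + 2)) :
    Continuous fun z : Fin m → ℝ => withEnds x y z k := by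
  refine Fin.cases continuous_const (fun k => ?_) k
  refine Fin.lastCases ?_ (fun k => ?_) k
  · simp only [Fin.succ_last, withEnds_last]; exact continuous_const
  · simp only [withEnds_castSucc_succ]; exact continuous_apply k

namespace TransitionDensity

variable (P : TransitionDensity) {δ : ℝ}

theorem knotLaw_equidistant (x y : ℝ) : P.knotLaw (equidistant m δ) x y =
    volume.withDensity fun z => ENNReal.ofReal
      ((∏ i : Fin (m + 1), P.p δ (withEnds x y z i.castSucc) (withEnds x y z i.succ)) /
        P.p ((m + 1) * δ) x y) := by
  simp only [knotLaw, equidistant_succ_sub, equidistant_last_sub_zero]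

theorem continuous_prod_withEnds (hδ : 0 < δ) (x y : ℝ) : Continuous fun z : Fin m → ℝ =>
    ∏ i : Fin (m + 1), P.p δ (withEnds x y z i.castSucc) (withEnds x y z i.succ) :=
  continuous_finsetProd _ fun i _ => (P.continuous δ hδ).comp
    ((continuous_withEnds x y i.castSucc).prodMk (continuous_withEnds x y i.succ))

theorem knotLaw_absolutelyContinuous {k : Fin (m + 2) → ℝ} (x y : ℝ) :
    P.knotLaw k x y ≪ volume := withDensity_absolutelyContinuous _ _

variable {P}

theorem measurable_left {t : ℝ} (ht : 0 < t) (y : ℝ) :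
    Measurable fun x => ENNReal.ofReal (P.p t x y) :=
  ((P.continuous t ht).comp (continuous_id.prodMk continuous_const)).measurable.ennreal_ofReal

theorem measurable_right {t : ℝ} (ht : 0 < t) (x : ℝ) :
    Measurable fun y => ENNReal.ofReal (P.p t x y) :=
  ((P.continuous t ht).comp (continuous_const.prodMk continuous_id)).measurable.ennreal_ofReal

theorem pos_add {s t : ℝ} (hs : 0 < s) (ht : 0 < t) (hps : ∀ x y, 0 < P.p s x y)
    (hpt : ∀ x y, 0 < P.p t x y) (x y : ℝ) : 0 < P.p (s + t) x y := by
  rw [← ENNReal.ofReal_pos, ← P.chapman_kolmogorov s t hs ht]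
  refine (lintegral_pos_iff_support
    ((measurable_right hs x).mul (measurable_left ht y))).2 ?_
  have : Function.support ((fun z => ENNReal.ofReal (P.p s x z)) *
      fun z => ENNReal.ofReal (P.p t z y)) = Set.univ := by
    ext z
    simp [hps x z, hpt z y]
  rw [this]
  simp

/-- The law of two equidistant knots of a bridge is a probability measure. -/
theorem knotLaw_two_univ (hδ : 0 < δ) (hp : ∀ x y, 0 < P.p δ x y) (u v : ℝ) :
    P.knotLaw (equidistant 2 δ) u v Set.univ = 1 := by
  have h2δ : 0 < δ + δ := by positivity
  have h3 : 0 < P.p (δ + (δ + δ)) u v := pos_add hδ h2δ hp (pos_add hδ hδ hp hp) u v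
  have e3 : ((2 : ℕ) + 1 : ℝ) * δ = δ + (δ + δ) := by push_cast; ring
  rw [knotLaw_equidistant, e3, withDensity_apply _ MeasurableSet.univ, Measure.restrict_univ]
  have hdens : ∀ z : Fin 2 → ℝ, ENNReal.ofReal ((∏ i : Fin 3, P.p δ (withEnds u v z i.castSucc)
      (withEnds u v z i.succ)) / P.p (δ + (δ + δ)) u v) =
      (fun w : ℝ × ℝ => ENNReal.ofReal (P.p δ u w.1) * (ENNReal.ofReal (P.p δ w.1 w.2) *
        ENNReal.ofReal (P.p δ w.2 v))) (MeasurableEquiv.finTwoArrow z) *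
          (ENNReal.ofReal (P.p (δ + (δ + δ)) u v))⁻¹ := fun z => by
    rw [ENNReal.ofReal_div_of_pos h3, div_eq_mul_inv]
    congr 1
    rw [Fin.prod_univ_three, mul_assoc, ENNReal.ofReal_mul (hp _ _).le,
      ENNReal.ofReal_mul (hp _ _).le]
    rfl
  have hmeas : Measurable fun w : ℝ × ℝ => ENNReal.ofReal (P.p δ u w.1) *
      (ENNReal.ofReal (P.p δ w.1 w.2) * ENNReal.ofReal (P.p δ w.2 v)) :=
    ((measurable_right hδ u).comp measurable_fst).mul
      ((P.continuous δ hδ).measurable.ennreal_ofReal.mul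
        ((measurable_left hδ v).comp measurable_snd))
  rw [lintegral_congr hdens,
    lintegral_mul_const (f := fun z => (fun w : ℝ × ℝ => ENNReal.ofReal (P.p δ u w.1) *
      (ENNReal.ofReal (P.p δ w.1 w.2) * ENNReal.ofReal (P.p δ w.2 v)))
        (MeasurableEquiv.finTwoArrow z)) _ (hmeas.comp MeasurableEquiv.finTwoArrow.measurable),
    (volume_preserving_finTwoArrow ℝ).lintegral_comp hmeas, Measure.volume_eq_prod,
    lintegral_prod _ hmeas.aemeasurable]
  -- Chapman–Kolmogorov collapses the inner integral here and the outer one below, producing exactly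
  -- the normalising density at `3δ`.
  have hinner : ∀ a, ∫⁻ b, ENNReal.ofReal (P.p δ u a) * (ENNReal.ofReal (P.p δ a b) *
      ENNReal.ofReal (P.p δ b v)) = ENNReal.ofReal (P.p δ u a) *
        ENNReal.ofReal (P.p (δ + δ) a v) := fun a => by
    rw [← P.chapman_kolmogorov δ δ hδ hδ]
    exact lintegral_const_mul _ ((measurable_right hδ a).mul (measurable_left hδ v))
  simp_rw [hinner]
  rw [P.chapman_kolmogorov δ (δ + δ) hδ h2δ]
  exact ENNReal.mul_inv_cancel (ENNReal.ofReal_pos.2 h3).ne' ENNReal.ofReal_ne_top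

end TransitionDensity

/-- The correlation of the coordinates of a two-dimensional law with log-quadratic density. -/
theorem corr_eq_of_density {G : Measure (Fin 2 → ℝ)} {α β : ℝ} (hα : 0 < α)
    (hQ : (!![α, β; β, α] : Matrix (Fin 2) (Fin 2) ℝ).PosDef) (b : Fin 2 → ℝ) {K : ℝ} (hK : 0 ≤ K)
    (hG : G = volume.withDensity fun z => ENNReal.ofReal (K * Real.exp
      (-(1 / 2) * (z ⬝ᵥ (!![α, β; β, α] : Matrix (Fin 2) (Fin 2) ℝ).mulVec z) + b ⬝ᵥ z)))
    (hprob : G Set.univ = 1) : corr (fun z => z 0) (fun z => z 1) G = -β / α := by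
  have hcov := covMatrix_eq_inv_of_density hQ b hK hG hprob
  have hdet : 0 < α * α - β * β := by
    have := hQ.det_pos
    rwa [Matrix.det_fin_two_of] at this
  rw [Matrix.inv_def, Matrix.adjugate_fin_two_of, Matrix.det_fin_two_of,
    Ring.inverse_eq_inv'] at hcov
  have h01 : covariance (fun z : Fin 2 → ℝ => z 0) (fun z => z 1) G =
      (α * α - β * β)⁻¹ * -β := congrFun (congrFun hcov 0) 1
  have h00 : variance (fun z : Fin 2 → ℝ => z 0) G = (α * α - β * β)⁻¹ * α := by
    rw [← covariance_self (measurable_pi_apply 0).aemeasurable]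
    exact congrFun (congrFun hcov 0) 0
  have h11 : variance (fun z : Fin 2 → ℝ => z 1) G = (α * α - β * β)⁻¹ * α := by
    rw [← covariance_self (measurable_pi_apply 1).aemeasurable]
    exact congrFun (congrFun hcov 1) 1
  rw [corr, h01, h00, h11, Real.sqrt_mul_self (by positivity)]
  rw [mul_div_mul_left _ _ (inv_ne_zero hdet.ne')]

end Bridge

/-! ### Identification of the precision matrix -/

section Main

variable {m : ℕ}

/-- A single site has no neighbours, so every `c` is admissible; in the result it is multiplied by
`cos(π/2) = 0`. -/
theorem hasPathPrecision_one {G : Measure (Fin 1 → ℝ)} (h : (covMatrix G).PosDef) (c : ℝ) :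
    HasPathPrecision G c := by
  refine ⟨Matrix.nonsing_inv_mul _ (isUnit_iff_ne_zero.2 h.det_pos.ne'), precMatrix G 0 0,
    (h.inv.diag_pos (i := 0)).ne', ?_⟩
  have : pathAdj 1 = 0 := by
    ext i j
    exact pathAdj_eq_zero (by omega)
  ext i j
  rw [this, Subsingleton.elim i 0, Subsingleton.elim j 0]
  simp

/-- Two densities of one law agree almost everywhere, and by continuity everywhere. Positivity of
the Gaussian density rules out a zero normaliser. -/
theorem prod_eq_of_isGaussian (P : TransitionDensity) {δ x y : ℝ} (hδ : 0 < δ)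
    {G : Measure (Fin m → ℝ)} (hG : G = P.knotLaw (equidistant m δ) x y) [IsGaussian G] :
    ∃ K : ℝ, 0 < K ∧ ∀ z : Fin m → ℝ,
      (∏ i : Fin (m + 1), P.p δ (withEnds x y z i.castSucc) (withEnds x y z i.succ)) =
        K * Real.exp (-(1 / 2) *
          ((z - meanVec G) ⬝ᵥ (precMatrix G).mulVec (z - meanVec G))) := by
  obtain ⟨K, hK, hdens⟩ := exists_eq_withDensity (G := G)
    (posDef_covMatrix (hG ▸ P.knotLaw_absolutelyContinuous x y))
  set E : (Fin m → ℝ) → ℝ := fun z => K * Real.exp (-(1 / 2) *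
          ((z - meanVec G) ⬝ᵥ (precMatrix G).mulVec (z - meanVec G))) with hE
  have hEc : Continuous E := by
    simp only [hE, dotProduct, Matrix.mulVec]
    fun_prop
  set D := P.p ((m + 1) * δ) x y
  have hD0 : 0 ≤ D := P.nonneg _ (by positivity) _ _
  set R : (Fin m → ℝ) → ℝ := fun z =>
    ∏ i : Fin (m + 1), P.p δ (withEnds x y z i.castSucc) (withEnds x y z i.succ) with hR
  have hRc : Continuous R := P.continuous_prod_withEnds hδ x y
  have hR0 : ∀ z, 0 ≤ R z := fun z => Finset.prod_nonneg fun i _ => P.nonneg δ hδ _ _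
  have hEpos : ∀ z, 0 < E z := fun z => by positivity
  have hae : (fun z => R z / D) =ᵐ[volume] E := by
    have h1 : volume.withDensity (fun z => ENNReal.ofReal (R z / D)) =
        volume.withDensity fun z => ENNReal.ofReal (E z) := by
      rw [← hdens, hG, P.knotLaw_equidistant]
    have h2 := (withDensity_eq_iff_of_sigmaFinite
      (hRc.div_const D).measurable.ennreal_ofReal.aemeasurable
      hEc.measurable.ennreal_ofReal.aemeasurable).1 h1
    filter_upwards [h2] with z hz
    exact (ENNReal.ofReal_eq_ofReal_iff (div_nonneg (hR0 z) hD0) (hEpos z).le).1 hz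
  have heq := (Continuous.ae_eq_iff_eq volume (hRc.div_const D) hEc).1 hae
  have hD : 0 < D := hD0.lt_of_ne fun h => by
    have := congrFun heq 0
    simp only [← h, div_zero] at this
    exact (hEpos 0).ne this
  refine ⟨D * K, by positivity, fun z => ?_⟩
  have := congrFun heq z
  simp only [hE] at this
  rw [div_eq_iff hD.ne'] at this
  rw [hR] at this
  exact this.trans (by ring)

theorem hasPathPrecision_bridgeCorr (P : TransitionDensity) {n : ℕ} {δ x y : ℝ} (hδ : 0 < δ)
    {G : Measure (Fin (n + 2) → ℝ)} (hG : G = P.knotLaw (equidistant (n + 2) δ) x y)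
    [IsGaussian G] (u v : ℝ) : HasPathPrecision G (P.bridgeCorr δ u v) := by
  have hS : (covMatrix G).PosDef := posDef_covMatrix (hG ▸ P.knotLaw_absolutelyContinuous x y)
  have hL : (precMatrix G).PosDef := hS.inv
  have hsymm : (precMatrix G).IsSymm := by
    rw [Matrix.IsSymm, ← Matrix.conjTranspose_eq_transpose_of_trivial]; exact hL.isHermitian
  obtain ⟨K, hK, hprod⟩ := prod_eq_of_isGaussian P hδ hG
  -- With `s`, `t` as the leading knots, `p δ s t` is a factor of a strictly positive product.
  have hp : ∀ s t, 0 < P.p δ s t := fun s t => by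
    refine (P.nonneg δ hδ s t).lt_of_ne fun h0 => ?_
    have h1 := hprod (Fin.cons s (Fin.cons t 0 : Fin (n + 1) → ℝ))
    rw [Finset.prod_eq_zero (Finset.mem_univ 1)] at h1
    · have : 0 < K * Real.exp (-(1 / 2) * ((Fin.cons s (Fin.cons t 0 : Fin (n + 1) → ℝ) -
        meanVec G) ⬝ᵥ (precMatrix G).mulVec (Fin.cons s (Fin.cons t 0 : Fin (n + 1) → ℝ) -
          meanVec G))) := by positivity
      exact this.ne h1
    · rw [withEnds_castSucc, withEnds_succ, snoc_cons]
      exact h0.symm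
  set q : ℝ → ℝ → ℝ := fun s t => Real.log (P.p δ s t)
  have hexp : ∀ {k : ℕ} (w : Fin (k + 1) → ℝ), Real.exp (chainSum q w) =
      ∏ i : Fin k, P.p δ (w i.castSucc) (w i.succ) := fun w => by
    rw [chainSum, Real.exp_sum]
    exact Finset.prod_congr rfl fun i _ => Real.exp_log (hp _ _)
  set μ := meanVec G
  set Λ := precMatrix G
  obtain ⟨F, H, l, k, hq, hg, hpath⟩ := exists_quadratic_of_chainSum (q := q) (x := x) (y := y)
    (κ := Real.log K - 1 / 2 * (μ ⬝ᵥ Λ.mulVec μ)) (b := Λ.mulVec μ) hsymm fun z => by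
      have h1 : μ ⬝ᵥ Λ.mulVec z = Λ.mulVec μ ⬝ᵥ z := by
        rw [Matrix.dotProduct_mulVec, ← Matrix.mulVec_transpose, hsymm]
      rw [← Real.log_exp (chainSum q (withEnds x y z)), hexp, hprod,
        Real.log_mul hK.ne' (Real.exp_pos _).ne', Real.log_exp]
      simp only [Matrix.mulVec_sub, dotProduct_sub, sub_dotProduct, h1]
      rw [dotProduct_comm z (Λ.mulVec μ)]
      ring
  set α := Λ 0 0
  set β := Λ 0 1
  have hα : 0 < α := hL.diag_pos
  -- The matrix is the leading principal block of `Λ`, hence positive definite.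
  have hQ : (!![α, β; β, α] : Matrix (Fin 2) (Fin 2) ℝ).PosDef := by
    have h11 : Λ 1 1 = α := by
      rw [hpath, Matrix.add_apply, Matrix.smul_apply, Matrix.smul_apply,
        pathAdj_eq_zero (by simp)]
      simp
    have hsub : (!![α, β; β, α] : Matrix (Fin 2) (Fin 2) ℝ) = Λ.submatrix ![0, 1] ![0, 1] := by
      ext i j
      fin_cases i <;> fin_cases j <;> simp [α, β, h11, hsymm.apply 0 1]
    rw [hsub]
    refine hL.submatrix fun i j hij => ?_
    fin_cases i <;> fin_cases j <;> simp_all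
  have hcorr : P.bridgeCorr δ u v = -β / α := by
    have h3 : 0 < P.p (((2 : ℕ) + 1) * δ) u v := by
      rw [show ((2 : ℕ) + 1 : ℝ) * δ = δ + (δ + δ) by push_cast; ring]
      exact TransitionDensity.pos_add hδ (by positivity) hp
        (TransitionDensity.pos_add hδ hδ hp hp) u v
    -- The ends `u`, `v` contribute only the linear terms `-β u z₀`, `-β v z₁` and a constant
    -- factor, so the correlation does not depend on them.
    refine corr_eq_of_density hα hQ ![l - β * u, l - β * v]
      (K := Real.exp (F u + H v + 2 * k) / P.p (((2 : ℕ) + 1) * δ) u v) (by positivity) ?_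
      (TransitionDensity.knotLaw_two_univ hδ hp u v)
    rw [P.knotLaw_equidistant]
    congr 1
    ext z
    rw [← hexp, div_mul_eq_mul_div, ← Real.exp_add]
    congr 3
    have hq' : q = fun s t => -β * (s * t) + F s + H t := by ext s t; exact hq s t
    rw [hq', chainSum_add_add]
    have hw : chainSum (fun a b => a * b) (withEnds u v z) = u * z 0 + z 0 * z 1 + z 1 * v :=
      Fin.sum_univ_three _
    rw [hw]
    simp [hg, Fin.sum_univ_two, dotProduct, Matrix.mulVec]
    ring
  refine ⟨Matrix.nonsing_inv_mul _ (isUnit_iff_ne_zero.2 hS.det_pos.ne'), α, hα.ne', ?_⟩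
  rw [hcorr]
  refine hpath.trans ?_
  rw [smul_sub, smul_smul, mul_div_cancel₀ _ hα.ne', neg_smul, sub_neg_eq_add]

end Main

theorem theorem2 (P : TransitionDensity) (m : ℕ) (hm : 1 ≤ m) (T : ℝ) (hT : 0 < T) (x₀ x_T : ℝ)
    (δ : ℝ) (hδ : δ = T / (m + 1))
    (G : Measure (Fin m → ℝ)) (hG : G = P.knotLaw (equidistant m δ) x₀ x_T) [IsGaussian G]
    (u v : ℝ) (c : ℝ) (hc : c = P.bridgeCorr δ u v) :
    IsMaxEigenvalue (matrixA G) (2 * |c| * Real.cos (Real.pi / (m + 1))) ∧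
    (∀ A : Fin 2 → Finset (Fin m), IsInterlacedPartition A →
      IsL2ConvergenceRate G ((checkerboard A).sweep G)
        (4 * c ^ 2 * Real.cos (Real.pi / (m + 1)) ^ 2)) ∧
    IsL2ConvergenceRate G ((lexicographic m).sweep G)
      (4 * c ^ 2 * Real.cos (Real.pi / (m + 1)) ^ 2) ∧
    IsL2ConvergenceRate G ((randomScan m).sweep G)
      (((m - 1 + 2 * |c| * Real.cos (Real.pi / (m + 1))) / m) ^ m) := by
  have hδ0 : 0 < δ := by rw [hδ]; positivity
  have h : HasPathPrecision G c := by
    obtain _ | _ | n := m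
    · omega
    · exact hasPathPrecision_one
        (posDef_covMatrix (hG ▸ P.knotLaw_absolutelyContinuous x₀ x_T)) c
    · rw [hc]; exact hasPathPrecision_bridgeCorr P hδ0 hG u v
  have hsq : 4 * c ^ 2 * Real.cos (Real.pi / (m + 1)) ^ 2 = pathTop m c ^ 2 := by
    rw [pathTop, mul_pow, mul_pow, sq_abs]; norm_num
  rw [hsq]
  refine ⟨?_, fun A hA => h.isL2ConvergenceRate_checkerboard hm hA,
    h.isL2ConvergenceRate_lexicographic hm, h.isL2ConvergenceRate_randomScan hm⟩
  rw [h.matrixA_eq]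
  exact isMaxEigenvalue_smul_pathAdj hm c
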